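/- **Setting.** Time is $t=0,1,2,\dots$. There are a consumption good, housing service, and a housing stock in unit supply that yields one unit of housing service per period. An agent born at date $t$ chooses consumption $y>0$ when young, consumption $z>0$ when old, housing service $h>0$ and a position $x\in\mathbb{R}$ in the housing stock so as to maximize $U(y,z,h)$ subject to $y+P_tx+r_th\le e_t^y$ and $z\le e_{t+1}^o+(P_{t+1}+r_{t+1})x$, where $P_t\ge 0$ is the housing price and $r_t\ge 0$ the rent. An *equilibrium* is a sequence of prices $(P_t,r_t)$ and allocations $(c_t^y,c_t^o,h_t,x_t)$ such that, for every $t$, $(c_t^y,c_{t+1}^o,h_t,x_t)$ solves this problem, $c_t^y+c_t^o=e_t^y+e_t^o$, $h_t=1$ and $x_t=1$. Put $S_t=P_t+r_t$, $R_t=(P_{t+1}+r_{t+1})/P_t$ (the gross interest rate), $q_t=1/\prod_{s=0}^{t-1}R_s$ and $V_t=\frac1{q_t}\sum_{s=t+1}^\infty q_sr_s$ (the present value of rents, which is finite in equilibrium). An equilibrium is *fundamental* if $P_t=V_t$ for all $t$, and *bubbly* if $P_t>V_t$ for all $t$. **Assumptions.** (1) The endowments $e_t^y,e_t^o$ are positive,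 and there are $G>1$ and $e_1,e_2>0$ such that $(e_t^y,e_t^o)=(e_1G^t,e_2G^t)$ for all sufficiently large $t$. Let $w=e_2/e_1$. (2) $U(y,z,h)=\frac{c(y,z)^{1-\gamma}}{1-\gamma}+v(h)$ with $0<\gamma<1$; $v$ is continuously differentiable on $(0,\infty)$ with $v'>0$; and $U$ is strictly quasi-concave on $(0,\infty)^3$. Let $m=v'(1)$. (3) $c:(0,\infty)^2\to(0,\infty)$ is homogeneous of degree $1$, quasi-concave, and twice continuously differentiable, with $c_y>0$, $c_z>0$, $c_{yy}<0$, $c_{zz}<0$, $\lim_{y\downarrow0}c_y(y,z)=\infty$ for every $z>0$ and $\lim_{z\downarrow0}c_z(y,z)=\infty$ for every $y>0$. An equilibrium is a *long run equilibrium* if the sequence $\left(\frac{S_t}{e_1G^t},\ e_1^{\gamma-1}G^{(\gamma-1)t}\right)$ converges. **Theorem ((Non)existence of fundamental equilibria).** Under these assumptions the following hold. 1. There is a unique $w_f^*>0$ with $\frac{c_y}{c_z}(1,Gw_f^*)=G^\gamma$. 2. If $w>w_f^*$, there exists a fundamental long run equilibrium. In every fundamental long run equilibrium, as $t\to\infty$,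 $$(c_t^y,c_t^o)\sim(e_1G^t,\,e_2G^t),$$ $$(P_t,r_t)\sim\left(me_1^\gamma\,\frac{G^\gamma c_z}{c_y-G^\gamma c_z}\,\frac{c^\gamma}{c_y}\,G^{\gamma t},\ me_1^\gamma\,\frac{c^\gamma}{c_y}\,G^{\gamma t}\right),$$ $$R_t\sim\frac{c_y}{c_z}>G^\gamma,$$ componentwise, where $c,c_y,c_z$ are evaluated at $(1,Gw)$, and $a_t\sim b_t$ means $a_t/b_t\to1$. 3. If $w<w_f^*$, there is no fundamental equilibrium, and every equilibrium is bubbly with $\liminf_{t\to\infty}G^{-t}P_t>0$. -/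

import Mathlib

open Filter Topology Set Asymptotics

noncomputable section

/-- Strict quasi-concavity of a real function on a convex set `s`. -/
def StrictQuasiconcaveOn {E : Type*} [AddCommGroup E] [Module ℝ E] (s : Set E) (f : E → ℝ) :
    Prop :=
  Convex ℝ s ∧ ∀ x ∈ s, ∀ y ∈ s, x ≠ y → ∀ a b : ℝ, 0 < a → 0 < b → a + b = 1 →
    min (f x) (f y) < f (a • x + b • y)

/-- The open positive quadrant. -/
def posQuadrant : Set (ℝ × ℝ) := {p | 0 < p.1 ∧ 0 < p.2}

/-- The open positive octant. -/
def posOctant : Set (ℝ × ℝ × ℝ) := {p | 0 < p.1 ∧ 0 < p.2.1 ∧ 0 < p.2.2}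

/-- Partial derivative of `c (y, z)` in `y`. -/
def partialY (c : ℝ → ℝ → ℝ) (y z : ℝ) : ℝ := deriv (fun y' => c y' z) y

/-- Partial derivative of `c (y, z)` in `z`. -/
def partialZ (c : ℝ → ℝ → ℝ) (y z : ℝ) : ℝ := deriv (fun z' => c y z') z

/-- Assumptions on the composite consumption `c (y, z)` of a young agent who consumes `y` when
young and `z` when old.  Only the values of `c` at positive arguments matter. -/
structure IsCompositeConsumption (c : ℝ → ℝ → ℝ) : Prop where
  pos : ∀ y z, 0 < y → 0 < z → 0 < c y z
  homogeneous : ∀ k y z, 0 < k → 0 < y → 0 < z → c (k * y) (k * z) = k * c y z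
  quasiconcave : QuasiconcaveOn ℝ posQuadrant (fun p => c p.1 p.2)
  contDiff : ContDiffOn ℝ 2 (fun p : ℝ × ℝ => c p.1 p.2) posQuadrant
  partialY_pos : ∀ y z, 0 < y → 0 < z → 0 < partialY c y z
  partialZ_pos : ∀ y z, 0 < y → 0 < z → 0 < partialZ c y z
  partialYY_neg : ∀ y z, 0 < y → 0 < z → partialY (partialY c) y z < 0
  partialZZ_neg : ∀ y z, 0 < y → 0 < z → partialZ (partialZ c) y z < 0
  inada_y : ∀ z, 0 < z → Tendsto (fun y => partialY c y z) (𝓝[>] 0) atTop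
  inada_z : ∀ y, 0 < y → Tendsto (fun z => partialZ c y z) (𝓝[>] 0) atTop

/-- The utility `U (y, z, h) = u (c (y, z)) + v (h)` with `u (c) = c ^ (1 - γ) / (1 - γ)`
(used for `γ ≠ 1` only). -/
def utility (γ : ℝ) (c : ℝ → ℝ → ℝ) (v : ℝ → ℝ) (y z h : ℝ) : ℝ :=
  c y z ^ (1 - γ) / (1 - γ) + v h

/-- Assumptions on the utility of housing service `v`, given `γ` and `c`: `v` is continuously
differentiable with `v' > 0` on the positive half-line (so that `utility γ c v` is continuously
differentiable with positive partial derivatives), and `utility γ c v` is strictly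
quasi-concave. -/
structure IsHousingUtility (γ : ℝ) (c : ℝ → ℝ → ℝ) (v : ℝ → ℝ) : Prop where
  contDiff : ContDiffOn ℝ 1 v (Ioi 0)
  deriv_pos : ∀ h, 0 < h → 0 < deriv v h
  strictQuasiconcave : StrictQuasiconcaveOn posOctant (fun p => utility γ c v p.1 p.2.1 p.2.2)

/-- The endowments `(ey t, eo t)` of the young and the old at date `t` are positive and equal
`(e₁ G ^ t, e₂ G ^ t)` for all sufficiently large `t`. -/
structure IsEndowment (G e₁ e₂ : ℝ) (ey eo : ℕ → ℝ) : Prop where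
  young_pos : ∀ t, 0 < ey t
  old_pos : ∀ t, 0 < eo t
  eventually_growth : ∃ T : ℕ, ∀ t, T ≤ t → ey t = e₁ * G ^ t ∧ eo t = e₂ * G ^ t

/-- Sequences of prices and allocations. -/
structure PriceAllocation where
  /-- housing price, excluding the current rent -/
  P : ℕ → ℝ
  /-- rent -/
  r : ℕ → ℝ
  /-- consumption of the young -/
  cy : ℕ → ℝ
  /-- consumption of the old -/
  co : ℕ → ℝ
  /-- housing service -/
  h : ℕ → ℝ
  /-- housing stock -/
  x : ℕ → ℝ

namespace PriceAllocation

/-- The consumption set and the two budget constraints of the agent born at date `t`: `y` and `z`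
are the consumption when young and when old, `h` is the housing service, and `x` is the position
in the housing stock. -/
def InBudget (E : PriceAllocation) (ey eo : ℕ → ℝ) (t : ℕ) (y z h x : ℝ) : Prop :=
  0 < y ∧ 0 < z ∧ 0 < h ∧
    y + E.P t * x + E.r t * h ≤ ey t ∧
    z ≤ eo (t + 1) + (E.P (t + 1) + E.r (t + 1)) * x

/-- Rational expectations equilibrium of the economy with utility `U` and endowments
`(ey t, eo t)`.  Prices are nonnegative. -/
structure IsEquilibrium (E : PriceAllocation) (U : ℝ → ℝ → ℝ → ℝ) (ey eo : ℕ → ℝ) : Prop where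
  price_nonneg : ∀ t, 0 ≤ E.P t
  rent_nonneg : ∀ t, 0 ≤ E.r t
  budget : ∀ t, E.InBudget ey eo t (E.cy t) (E.co (t + 1)) (E.h t) (E.x t)
  optimal : ∀ t y z h x, E.InBudget ey eo t y z h x → U y z h ≤ U (E.cy t) (E.co (t + 1)) (E.h t)
  commodity_clearing : ∀ t, E.cy t + E.co t = ey t + eo t
  rental_clearing : ∀ t, E.h t = 1
  housing_clearing : ∀ t, E.x t = 1

/-- Housing expenditure `S t = P t + r t`. -/
def S (E : PriceAllocation) (t : ℕ) : ℝ := E.P t + E.r t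

/-- Gross risk-free rate between `t` and `t + 1`. -/
def R (E : PriceAllocation) (t : ℕ) : ℝ := (E.P (t + 1) + E.r (t + 1)) / E.P t

/-- Arrow-Debreu price of date-`t` consumption in units of date-`0` consumption. -/
def q (E : PriceAllocation) (t : ℕ) : ℝ := 1 / ∏ s ∈ Finset.range t, E.R s

/-- Fundamental value of housing at date `t`: the present value of the rents at the dates
`t + 1, t + 2, …`. -/
def V (E : PriceAllocation) (t : ℕ) : ℝ :=
  1 / E.q t * ∑' k : ℕ, E.q (t + 1 + k) * E.r (t + 1 + k)

/-- There is no housing bubble: the housing price equals the (finite) present value of rents. -/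
def IsFundamental (E : PriceAllocation) : Prop :=
  Summable (fun t => E.q t * E.r t) ∧ ∀ t, E.P t = E.V t

/-- There is a housing bubble: the housing price exceeds the (finite) present value of rents. -/
def IsBubbly (E : PriceAllocation) : Prop :=
  Summable (fun t => E.q t * E.r t) ∧ ∀ t, E.V t < E.P t

/-- The detrended sequence `ξ t = (S t / (e₁ G ^ t), e₁ ^ (γ - 1) G ^ ((γ - 1) t))` converges. -/
def IsLongRun (E : PriceAllocation) (γ G e₁ : ℝ) : Prop :=
  ∃ ξ : ℝ × ℝ, Tendsto
    (fun t : ℕ => (E.S t / (e₁ * G ^ t), e₁ ^ (γ - 1) * G ^ ((γ - 1) * (t : ℝ)))) atTop (𝓝 ξ)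

end PriceAllocation

end

/-!
An agent holds the whole housing stock, so the consumptions are `ey t - S t` and `eo t + S t`, and
the first-order conditions read `P t * c_y = S (t + 1) * c_z` and `r t * c_y = m * c ^ γ`, where
`m = v' 1`. They are necessary (`PriceAllocation.IsEquilibrium.isEulerPath`) and, by
quasi-concavity of the utility, sufficient (`IsEulerPath.isEquilibrium`). Equilibria are thus the
solutions `0 < S t < ey t` of the Euler equation `S t * c_y = S (t + 1) * c_z + m * c ^ γ`, and the
interest rate is the marginal rate of substitution `mrs c = c_y / c_z` at the consumption bundle.
Two facts drive everything.

* By homogeneity, `c_yy < 0` and `c_zz < 0` make `mrs c y z` decreasing in `y` and increasing in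
  `z`; so interest rates are, at late dates, at least the autarky rate `M = mrs c e₁ (G e₂)` at
  which agents consume their endowments, and `M` compares with `G ^ γ` as `w` does with `wf`.
* `c_y` is bounded below and `c` is of order `G ^ t`, so that rents are `O(G ^ (γ t))` in every
  equilibrium (`housingMRS_le_mul_pow`), which is of lower order than the endowments.

The present value `q t * P t` of the price decreases to a limit, which is the bubble; it is positive
if `r t / P t` is summable (`PriceAllocation.isBubbly_of_summable`). So there is a bubble whenever
`S t ≥ δ G ^ t` eventually.

If `M < G ^ γ`, this lower bound always holds (`IsEulerPath.exists_mul_pow_le`): once `S t / G ^ t`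
is small it stays small, and then `S` grows at a rate below `G ^ γ` and falls short of the rent,
which is of exact order `G ^ (γ t)`.

If `M > G ^ γ`, a fundamental long run equilibrium cannot have `S t / G ^ t` converge to a positive
limit, so this ratio tends to `0` and the arguments of `c_y` and `c_z` tend to the endowments; this
gives the asymptotics of the rent and the interest rate, and that of the price because
`p t = P t / G ^ (γ t)` is a bounded solution of a forward-looking contraction
(`tendsto_of_forward_recursion`). For existence, the Euler equation is solved backwards from a
small value at a distant date `N`; each backward step preserves a bound `S t ≤ K G ^ (γ t)` with `K`
independent of `N`, and compactness gives an infinite solution with this bound (`exists_isEulerPath_le_mul_pow`), for which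
`q t * P t` tends to `0`.
-/

/-! ### Composite consumption and its marginal rate of substitution -/

noncomputable section

theorem isOpen_posQuadrant : IsOpen posQuadrant :=
  (isOpen_lt continuous_const continuous_fst).inter (isOpen_lt continuous_const continuous_snd)

theorem tendsto_comp_of_continuousOn_posQuadrant {F : ℝ → ℝ → ℝ}
    (hF : ContinuousOn (fun p : ℝ × ℝ => F p.1 p.2) posQuadrant)
    {α : Type*} {l : Filter α} {f g : α → ℝ} {y z : ℝ} (hy : 0 < y) (hz : 0 < z)
    (hf : Tendsto f l (𝓝 y)) (hg : Tendsto g l (𝓝 z)) :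
    Tendsto (fun a => F (f a) (g a)) l (𝓝 (F y z)) :=
  (hF.continuousAt (x := (y, z)) (isOpen_posQuadrant.mem_nhds ⟨hy, hz⟩)).tendsto.comp
    (hf.prodMk_nhds hg)

namespace IsCompositeConsumption

variable {c : ℝ → ℝ → ℝ}

theorem hasFDerivAt (hc : IsCompositeConsumption c) {y z : ℝ} (hy : 0 < y) (hz : 0 < z) :
    HasFDerivAt (fun p : ℝ × ℝ => c p.1 p.2)
      (fderiv ℝ (fun p : ℝ × ℝ => c p.1 p.2) (y, z)) (y, z) :=
  ((hc.contDiff.contDiffAt (isOpen_posQuadrant.mem_nhds ⟨hy, hz⟩)).differentiableAt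
    (by norm_num)).hasFDerivAt

theorem hasDerivAt_comp_fderiv (hc : IsCompositeConsumption c) {f g : ℝ → ℝ} {f' g' s : ℝ}
    (hy : 0 < f s) (hz : 0 < g s) (hf : HasDerivAt f f' s) (hg : HasDerivAt g g' s) :
    HasDerivAt (fun s => c (f s) (g s))
      (fderiv ℝ (fun p : ℝ × ℝ => c p.1 p.2) (f s, g s) (f', g')) s :=
  (hc.hasFDerivAt hy hz).comp_hasDerivAt (f := fun s => (f s, g s)) s (hf.prodMk hg)

theorem partialY_eq_fderiv (hc : IsCompositeConsumption c) {y z : ℝ} (hy : 0 < y) (hz : 0 < z) :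
    partialY c y z = fderiv ℝ (fun p : ℝ × ℝ => c p.1 p.2) (y, z) (1, 0) :=
  (hc.hasDerivAt_comp_fderiv (f := fun y => y) (g := fun _ => z) hy hz (hasDerivAt_id y)
    (hasDerivAt_const y z)).deriv

theorem partialZ_eq_fderiv (hc : IsCompositeConsumption c) {y z : ℝ} (hy : 0 < y) (hz : 0 < z) :
    partialZ c y z = fderiv ℝ (fun p : ℝ × ℝ => c p.1 p.2) (y, z) (0, 1) :=
  (hc.hasDerivAt_comp_fderiv (f := fun _ => y) (g := fun z => z) hy hz (hasDerivAt_const z y)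
    (hasDerivAt_id z)).deriv

/-- Chain rule for `c` along a curve in the positive quadrant. -/
theorem hasDerivAt_comp (hc : IsCompositeConsumption c) {f g : ℝ → ℝ} {f' g' s : ℝ}
    (hy : 0 < f s) (hz : 0 < g s) (hf : HasDerivAt f f' s) (hg : HasDerivAt g g' s) :
    HasDerivAt (fun s => c (f s) (g s))
      (f' * partialY c (f s) (g s) + g' * partialZ c (f s) (g s)) s := by
  convert hc.hasDerivAt_comp_fderiv hy hz hf hg using 1
  rw [hc.partialY_eq_fderiv hy hz, hc.partialZ_eq_fderiv hy hz]
  have : ((f', g') : ℝ × ℝ) = f' • (1, 0) + g' • (0, 1) := by ext <;> simp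
  rw [this, map_add, map_smul, map_smul]; rfl

theorem hasDerivAt_left (hc : IsCompositeConsumption c) {y z : ℝ} (hy : 0 < y) (hz : 0 < z) :
    HasDerivAt (fun y => c y z) (partialY c y z) y := by
  simpa using hc.hasDerivAt_comp (f := fun y => y) (g := fun _ => z) hy hz (hasDerivAt_id y)
    (hasDerivAt_const y z)

theorem hasDerivAt_right (hc : IsCompositeConsumption c) {y z : ℝ} (hy : 0 < y) (hz : 0 < z) :
    HasDerivAt (fun z => c y z) (partialZ c y z) z := by
  simpa using hc.hasDerivAt_comp (f := fun _ => y) (g := fun z => z) hy hz (hasDerivAt_const z y)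
    (hasDerivAt_id z)

theorem continuousOn (hc : IsCompositeConsumption c) :
    ContinuousOn (fun p : ℝ × ℝ => c p.1 p.2) posQuadrant :=
  hc.contDiff.continuousOn

theorem continuousOn_fderiv (hc : IsCompositeConsumption c) :
    ContinuousOn (fderiv ℝ (fun p : ℝ × ℝ => c p.1 p.2)) posQuadrant :=
  hc.contDiff.continuousOn_fderiv_of_isOpen isOpen_posQuadrant (by norm_num)

theorem continuousOn_partialY (hc : IsCompositeConsumption c) :
    ContinuousOn (fun p : ℝ × ℝ => partialY c p.1 p.2) posQuadrant :=
  (hc.continuousOn_fderiv.clm_apply continuousOn_const).congr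
    fun _ hp => hc.partialY_eq_fderiv hp.1 hp.2

theorem continuousOn_partialZ (hc : IsCompositeConsumption c) :
    ContinuousOn (fun p : ℝ × ℝ => partialZ c p.1 p.2) posQuadrant :=
  (hc.continuousOn_fderiv.clm_apply continuousOn_const).congr
    fun _ hp => hc.partialZ_eq_fderiv hp.1 hp.2

theorem partialY_homogeneous (hc : IsCompositeConsumption c) {k y z : ℝ} (hk : 0 < k) (hy : 0 < y)
    (hz : 0 < z) : partialY c (k * y) (k * z) = partialY c y z := by
  have h1 : HasDerivAt (fun y => c (k * y) (k * z)) (k * partialY c (k * y) (k * z)) y := by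
    have := hc.hasDerivAt_comp (f := fun y => k * y) (g := fun _ => k * z) (s := y)
      (by positivity) (by positivity) ((hasDerivAt_id y).const_mul k) (hasDerivAt_const y (k * z))
    simpa using this
  have h2 : HasDerivAt (fun y => c (k * y) (k * z)) (k * partialY c y z) y := by
    refine ((hc.hasDerivAt_left hy hz).const_mul k).congr_of_eventuallyEq ?_
    filter_upwards [lt_mem_nhds hy] with y' hy'
    exact hc.homogeneous k y' z hk hy' hz
  exact mul_left_cancel₀ hk.ne' (h1.unique h2)

theorem partialZ_homogeneous (hc : IsCompositeConsumption c) {k y z : ℝ} (hk : 0 < k) (hy : 0 < y)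
    (hz : 0 < z) : partialZ c (k * y) (k * z) = partialZ c y z := by
  have h1 : HasDerivAt (fun z => c (k * y) (k * z)) (k * partialZ c (k * y) (k * z)) z := by
    have := hc.hasDerivAt_comp (f := fun _ => k * y) (g := fun z => k * z) (s := z)
      (by positivity) (by positivity) (hasDerivAt_const z (k * y)) ((hasDerivAt_id z).const_mul k)
    simpa using this
  have h2 : HasDerivAt (fun z => c (k * y) (k * z)) (k * partialZ c y z) z := by
    refine ((hc.hasDerivAt_right hy hz).const_mul k).congr_of_eventuallyEq ?_
    filter_upwards [lt_mem_nhds hz] with z' hz'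
    exact hc.homogeneous k y z' hk hy hz'
  exact mul_left_cancel₀ hk.ne' (h1.unique h2)

theorem partialY_lt_of_lt (hc : IsCompositeConsumption c) {y y' z : ℝ} (hy : 0 < y) (hyy : y < y')
    (hz : 0 < z) : partialY c y' z < partialY c y z := by
  have hanti : StrictAntiOn (fun y => partialY c y z) (Ioi 0) := by
    refine strictAntiOn_of_deriv_neg (convex_Ioi 0) ?_ ?_
    · exact hc.continuousOn_partialY.comp (f := fun y : ℝ => (y, z))
        (by fun_prop) fun y hy => ⟨hy, hz⟩
    · intro y hy
      rw [interior_Ioi] at hy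
      exact hc.partialYY_neg y z hy hz
  exact hanti hy (hy.trans hyy) hyy

theorem partialZ_lt_of_lt (hc : IsCompositeConsumption c) {y z z' : ℝ} (hy : 0 < y) (hz : 0 < z)
    (hzz : z < z') : partialZ c y z' < partialZ c y z := by
  have hanti : StrictAntiOn (fun z => partialZ c y z) (Ioi 0) := by
    refine strictAntiOn_of_deriv_neg (convex_Ioi 0) ?_ ?_
    · exact hc.continuousOn_partialZ.comp (f := fun z : ℝ => (y, z))
        (by fun_prop) fun z hz => ⟨hy, hz⟩
    · intro z hz
      rw [interior_Ioi] at hz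
      exact hc.partialZZ_neg y z hy hz
  exact hanti hz (hz.trans hzz) hzz

/-- By homogeneity, concavity of `c` in `y` makes `c_y` increasing in `z`: the goods are
complements. -/
theorem partialY_lt_of_lt_right (hc : IsCompositeConsumption c) {y z z' : ℝ} (hy : 0 < y)
    (hz : 0 < z) (hzz : z < z') : partialY c y z < partialY c y z' := by
  have hz' := hz.trans hzz
  have h1 : z / z' * z' = z := div_mul_cancel₀ z hz'.ne'
  rw [← hc.partialY_homogeneous (div_pos hz hz') hy hz', h1]
  exact hc.partialY_lt_of_lt (by positivity)
    (mul_lt_of_lt_one_left hy ((div_lt_one hz').2 hzz)) hz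

theorem partialZ_lt_of_lt_left (hc : IsCompositeConsumption c) {y y' z : ℝ} (hy : 0 < y)
    (hyy : y < y') (hz : 0 < z) : partialZ c y z < partialZ c y' z := by
  have hy' := hy.trans hyy
  have h1 : y / y' * y' = y := div_mul_cancel₀ y hy'.ne'
  rw [← hc.partialZ_homogeneous (div_pos hy hy') hy' hz, h1]
  exact hc.partialZ_lt_of_lt hy (by positivity)
    (mul_lt_of_lt_one_left hz ((div_lt_one hy').2 hyy))

theorem partialY_mono (hc : IsCompositeConsumption c) {y y' z z' : ℝ} (hy : 0 < y') (hyy : y' ≤ y)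
    (hz : 0 < z) (hzz : z ≤ z') : partialY c y z ≤ partialY c y' z' := by
  have h1 : partialY c y z ≤ partialY c y' z := by
    rcases hyy.eq_or_lt with rfl | h
    · rfl
    · exact (hc.partialY_lt_of_lt hy h hz).le
  have h2 : partialY c y' z ≤ partialY c y' z' := by
    rcases hzz.eq_or_lt with rfl | h
    · rfl
    · exact (hc.partialY_lt_of_lt_right hy hz h).le
  exact h1.trans h2

theorem partialZ_mono (hc : IsCompositeConsumption c) {y y' z z' : ℝ} (hy : 0 < y') (hyy : y' ≤ y)
    (hz : 0 < z) (hzz : z ≤ z') : partialZ c y' z' ≤ partialZ c y z := by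
  have h1 : partialZ c y' z ≤ partialZ c y z := by
    rcases hyy.eq_or_lt with rfl | h
    · rfl
    · exact (hc.partialZ_lt_of_lt_left hy h hz).le
  have h2 : partialZ c y' z' ≤ partialZ c y' z := by
    rcases hzz.eq_or_lt with rfl | h
    · rfl
    · exact (hc.partialZ_lt_of_lt hy hz h).le
  exact h2.trans h1

theorem lt_of_lt_left (hc : IsCompositeConsumption c) {y y' z : ℝ} (hy : 0 < y) (hyy : y < y')
    (hz : 0 < z) : c y z < c y' z := by
  have hmono : StrictMonoOn (fun y => c y z) (Ioi 0) := by
    refine strictMonoOn_of_deriv_pos (convex_Ioi 0)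
      (fun y hy => (hc.hasDerivAt_left hy hz).continuousAt.continuousWithinAt) fun y hy => ?_
    rw [interior_Ioi] at hy
    exact hc.partialY_pos y z hy hz
  exact hmono hy (hy.trans hyy) hyy

theorem lt_of_lt_right (hc : IsCompositeConsumption c) {y z z' : ℝ} (hy : 0 < y) (hz : 0 < z)
    (hzz : z < z') : c y z < c y z' := by
  have hmono : StrictMonoOn (fun z => c y z) (Ioi 0) := by
    refine strictMonoOn_of_deriv_pos (convex_Ioi 0)
      (fun z hz => (hc.hasDerivAt_right hy hz).continuousAt.continuousWithinAt) fun z hz => ?_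
    rw [interior_Ioi] at hz
    exact hc.partialZ_pos y z hy hz
  exact hmono hz (hz.trans hzz) hzz

theorem mono (hc : IsCompositeConsumption c) {y y' z z' : ℝ} (hy : 0 < y) (hyy : y ≤ y')
    (hz : 0 < z) (hzz : z ≤ z') : c y z ≤ c y' z' := by
  have h1 : c y z ≤ c y' z := by
    rcases hyy.eq_or_lt with rfl | h
    · rfl
    · exact (hc.lt_of_lt_left hy h hz).le
  have h2 : c y' z ≤ c y' z' := by
    rcases hzz.eq_or_lt with rfl | h
    · rfl
    · exact (hc.lt_of_lt_right (hy.trans_le hyy) hz h).le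
  exact h1.trans h2

end IsCompositeConsumption

/-- Marginal rate of substitution `c_y / c_z` at `(y, z)`. -/
def mrs (c : ℝ → ℝ → ℝ) (y z : ℝ) : ℝ := partialY c y z / partialZ c y z

namespace IsCompositeConsumption

variable {c : ℝ → ℝ → ℝ}

theorem mrs_pos (hc : IsCompositeConsumption c) {y z : ℝ} (hy : 0 < y) (hz : 0 < z) :
    0 < mrs c y z :=
  div_pos (hc.partialY_pos y z hy hz) (hc.partialZ_pos y z hy hz)

theorem mrs_homogeneous (hc : IsCompositeConsumption c) {k y z : ℝ} (hk : 0 < k) (hy : 0 < y)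
    (hz : 0 < z) : mrs c (k * y) (k * z) = mrs c y z := by
  rw [mrs, hc.partialY_homogeneous hk hy hz, hc.partialZ_homogeneous hk hy hz, mrs]

theorem mrs_mono (hc : IsCompositeConsumption c) {y y' z z' : ℝ} (hy : 0 < y') (hyy : y' ≤ y)
    (hz : 0 < z) (hzz : z ≤ z') : mrs c y z ≤ mrs c y' z' := by
  have := hc.partialY_pos y' z' hy (hz.trans_le hzz)
  exact div_le_div₀ this.le (hc.partialY_mono hy hyy hz hzz)
    (hc.partialZ_pos y' z' hy (hz.trans_le hzz)) (hc.partialZ_mono hy hyy hz hzz)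

theorem mrs_strictMono (hc : IsCompositeConsumption c) {y z z' : ℝ} (hy : 0 < y)
    (hz : 0 < z) (hzz : z < z') : mrs c y z < mrs c y z' := by
  have hz' := hz.trans hzz
  exact div_lt_div₀ (hc.partialY_lt_of_lt_right hy hz hzz) (hc.partialZ_lt_of_lt hy hz hzz).le
    (hc.partialY_pos y z' hy hz').le (hc.partialZ_pos y z' hy hz')

theorem continuousOn_mrs (hc : IsCompositeConsumption c) :
    ContinuousOn (fun p : ℝ × ℝ => mrs c p.1 p.2) posQuadrant :=
  hc.continuousOn_partialY.div hc.continuousOn_partialZ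
    fun _ hp => (hc.partialZ_pos _ _ hp.1 hp.2).ne'

/-- The marginal rate of substitution along `y = 1` takes every positive value exactly once, by
the Inada conditions. -/
theorem existsUnique_mrs_eq (hc : IsCompositeConsumption c) {a : ℝ} (ha : 0 < a) :
    ∃! z : ℝ, 0 < z ∧ mrs c 1 z = a := by
  have hA := hc.partialY_pos 1 1 one_pos one_pos
  have hB := hc.partialZ_pos 1 1 one_pos one_pos
  -- a point where the marginal rate of substitution is small
  obtain ⟨z₁, hz₁, hz₁1, h₁⟩ : ∃ z, 0 < z ∧ z < 1 ∧ mrs c 1 z ≤ a := by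
    have h1 := (hc.inada_z 1 one_pos).eventually (eventually_ge_atTop (partialY c 1 1 / a))
    have h2 : ∀ᶠ z : ℝ in 𝓝[>] 0, z ∈ Ioo (0 : ℝ) 1 := Ioo_mem_nhdsGT one_pos
    obtain ⟨z, hz, hz'⟩ := (h1.and h2).exists
    refine ⟨z, hz'.1, hz'.2, ?_⟩
    have h3 := hc.partialY_mono (y := 1) one_pos le_rfl hz'.1 hz'.2.le
    rw [mrs, div_le_iff₀ (hc.partialZ_pos 1 z one_pos hz'.1)]
    rw [div_le_iff₀ ha] at hz
    linarith
  -- a point where it is large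
  obtain ⟨z₂, hz₂, h₂⟩ : ∃ z, 1 < z ∧ a ≤ mrs c 1 z := by
    have h1 := (hc.inada_y 1 one_pos).eventually (eventually_ge_atTop (a * partialZ c 1 1))
    have h2 : ∀ᶠ y : ℝ in 𝓝[>] 0, y ∈ Ioo (0 : ℝ) 1 := Ioo_mem_nhdsGT one_pos
    obtain ⟨y, hy, hy'⟩ := (h1.and h2).exists
    have hy0 : 0 < y := hy'.1
    have h1y : 1 < y⁻¹ := (one_lt_inv₀ hy0).2 hy'.2
    refine ⟨y⁻¹, h1y, ?_⟩
    have h3 := hc.partialZ_mono (y := 1) one_pos le_rfl one_pos h1y.le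
    have h4 : partialY c 1 y⁻¹ = partialY c y 1 := by
      rw [← hc.partialY_homogeneous hy0 one_pos (inv_pos.2 hy0), mul_one, mul_inv_cancel₀ hy0.ne']
    rw [mrs, le_div_iff₀ (hc.partialZ_pos 1 _ one_pos (by positivity)), h4]
    exact (mul_le_mul_of_nonneg_left h3 ha.le).trans hy
  have hcont : ContinuousOn (fun z => mrs c 1 z) (Icc z₁ z₂) :=
    hc.continuousOn_mrs.comp (f := fun z : ℝ => ((1 : ℝ), z)) (by fun_prop)
      fun z hz => ⟨one_pos, hz₁.trans_le hz.1⟩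
  obtain ⟨z, hz, hza⟩ := intermediate_value_Icc (hz₁1.trans hz₂).le hcont ⟨h₁, h₂⟩
  refine ⟨z, ⟨hz₁.trans_le hz.1, hza⟩, fun z' hz' => ?_⟩
  rcases lt_trichotomy z' z with h | h | h
  · exact absurd (hc.mrs_strictMono one_pos hz'.1 h) (by rw [hz'.2]; simp_all)
  · exact h
  · exact absurd (hc.mrs_strictMono one_pos (hz₁.trans_le hz.1) h) (by rw [hz'.2]; simp_all)

end IsCompositeConsumption
end

/-! ### First-order conditions of the young -/

noncomputable section

variable {γ : ℝ} {c : ℝ → ℝ → ℝ} {v : ℝ → ℝ} {ey eo : ℕ → ℝ}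

theorem hasDerivAt_utility (hγ₁ : γ < 1) (hc : IsCompositeConsumption c)
    (hv : IsHousingUtility γ c v) {f g k : ℝ → ℝ} {f' g' k' s : ℝ}
    (hy : 0 < f s) (hz : 0 < g s) (hh : 0 < k s) (hf : HasDerivAt f f' s)
    (hg : HasDerivAt g g' s) (hk : HasDerivAt k k' s) :
    HasDerivAt (fun s => utility γ c v (f s) (g s) (k s))
      ((c (f s) (g s) ^ γ)⁻¹ * (f' * partialY c (f s) (g s) + g' * partialZ c (f s) (g s)) +
        deriv v (k s) * k') s := by
  have hγ : 1 - γ ≠ 0 := by linarith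
  have hcpos := hc.pos _ _ hy hz
  have h1 := ((hc.hasDerivAt_comp hy hz hf hg).rpow_const (p := 1 - γ)
    (Or.inl hcpos.ne')).div_const (1 - γ)
  have h2 : HasDerivAt v (deriv v (k s)) (k s) :=
    (((hv.contDiff).contDiffAt (Ioi_mem_nhds hh)).differentiableAt (by norm_num)).hasDerivAt
  refine (h1.add (h2.comp s hk)).congr_deriv ?_
  have h3 : c (f s) (g s) ^ (1 - γ - 1) = (c (f s) (g s) ^ γ)⁻¹ := by
    rw [← Real.rpow_neg hcpos.le]; congr 1; ring
  rw [h3]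
  field_simp

theorem utility_lt_utility (hγ₁ : γ < 1) (hc : IsCompositeConsumption c) {y z y' z' h : ℝ}
    (hy : 0 < y) (hz : 0 < z) (hlt : c y z < c y' z') :
    utility γ c v y z h < utility γ c v y' z' h := by
  have h1 : 0 < 1 - γ := by linarith
  have := Real.rpow_lt_rpow (hc.pos y z hy hz).le hlt h1
  have := div_lt_div_of_pos_right this h1
  simpa [utility] using this

/-- Marginal rate of substitution `m c ^ γ / c_y` of young-age consumption for housing service,
where `m` is the marginal utility of housing service. -/
def housingMRS (γ m : ℝ) (c : ℝ → ℝ → ℝ) (y z : ℝ) : ℝ := m * c y z ^ γ / partialY c y z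

/-- The data of an interior first-order condition at every date: `S` is a sequence of housing
expenditures for which the agent born at `t`, consuming `ey t - S t` when young and
`eo (t + 1) + S (t + 1)` when old, is indifferent to marginal changes of the position in housing,
the rent `r` satisfying `r c_y = m c ^ γ`. -/
structure IsEulerPath (γ m : ℝ) (c : ℝ → ℝ → ℝ) (ey eo S : ℕ → ℝ) : Prop where
  pos : ∀ t, 0 < S t
  lt : ∀ t, S t < ey t
  euler : ∀ t, S t * partialY c (ey t - S t) (eo (t + 1) + S (t + 1)) =
    S (t + 1) * partialZ c (ey t - S t) (eo (t + 1) + S (t + 1)) +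
      m * c (ey t - S t) (eo (t + 1) + S (t + 1)) ^ γ

namespace PriceAllocation

variable {E : PriceAllocation}

/-- First-order condition in the position in housing, from the perturbation
`(y - P s, z + S' s, h, x + s)`. -/
theorem IsEquilibrium.price_mul_partialY (hγ₁ : γ < 1) (hc : IsCompositeConsumption c)
    (hv : IsHousingUtility γ c v) (hE : E.IsEquilibrium (utility γ c v) ey eo) (t : ℕ) :
    E.P t * partialY c (E.cy t) (E.co (t + 1)) =
      E.S (t + 1) * partialZ c (E.cy t) (E.co (t + 1)) := by
  obtain ⟨hy, hz, hh, hb1, hb2⟩ := hE.budget t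
  rw [hE.rental_clearing, hE.housing_clearing] at hb1
  rw [hE.housing_clearing] at hb2
  have hd := hasDerivAt_utility (f := fun s => E.cy t - E.P t * s)
    (g := fun s => E.co (t + 1) + E.S (t + 1) * s) (k := fun _ => (1 : ℝ)) (s := 0) hγ₁ hc hv
    (by simpa using hy) (by simpa using hz) one_pos
    (((hasDerivAt_id (0 : ℝ)).const_mul (E.P t)).const_sub (E.cy t))
    (((hasDerivAt_id (0 : ℝ)).const_mul (E.S (t + 1))).const_add (E.co (t + 1)))
    (hasDerivAt_const 0 1)
  have hmax : IsLocalMax (fun s => utility γ c v (E.cy t - E.P t * s)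
      (E.co (t + 1) + E.S (t + 1) * s) 1) 0 := by
    have e1 : ∀ᶠ s in 𝓝 (0 : ℝ), 0 < E.cy t - E.P t * s :=
      (Continuous.tendsto (by fun_prop : Continuous fun s => E.cy t - E.P t * s) 0).eventually
        (lt_mem_nhds (by simpa using hy))
    have e2 : ∀ᶠ s in 𝓝 (0 : ℝ), 0 < E.co (t + 1) + E.S (t + 1) * s :=
      (Continuous.tendsto (by fun_prop :
        Continuous fun s => E.co (t + 1) + E.S (t + 1) * s) 0).eventually
        (lt_mem_nhds (by simpa using hz))
    filter_upwards [e1, e2] with s h1 h2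
    have := hE.optimal t _ _ 1 (1 + s) ⟨h1, h2, one_pos, by linarith, by rw [S]; linarith⟩
    simpa [hE.rental_clearing] using this
  have h0 := hmax.hasDerivAt_eq_zero hd
  have hcpos := Real.rpow_pos_of_pos (hc.pos _ _ hy hz) γ
  simp only [mul_zero, sub_zero, add_zero, mul_one] at h0
  have := (mul_eq_zero.1 h0).resolve_left (inv_pos.2 hcpos).ne'
  linarith

/-- First-order condition in the housing service, from the perturbation
`(y - r s, z, h + s, x)`. -/
theorem IsEquilibrium.rent_mul_partialY (hγ₁ : γ < 1) (hc : IsCompositeConsumption c)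
    (hv : IsHousingUtility γ c v) (hE : E.IsEquilibrium (utility γ c v) ey eo) (t : ℕ) :
    E.r t * partialY c (E.cy t) (E.co (t + 1)) =
      deriv v 1 * c (E.cy t) (E.co (t + 1)) ^ γ := by
  obtain ⟨hy, hz, hh, hb1, hb2⟩ := hE.budget t
  rw [hE.rental_clearing, hE.housing_clearing] at hb1
  rw [hE.housing_clearing] at hb2
  have hd := hasDerivAt_utility (f := fun s => E.cy t - E.r t * s)
    (g := fun _ => E.co (t + 1)) (k := fun s => 1 + s) (s := 0) hγ₁ hc hv
    (by simpa using hy) (by simpa using hz) (by simp)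
    (((hasDerivAt_id (0 : ℝ)).const_mul (E.r t)).const_sub (E.cy t))
    (hasDerivAt_const 0 _) ((hasDerivAt_id (0 : ℝ)).const_add 1)
  have hmax : IsLocalMax (fun s => utility γ c v (E.cy t - E.r t * s) (E.co (t + 1)) (1 + s))
      0 := by
    have e1 : ∀ᶠ s in 𝓝 (0 : ℝ), 0 < E.cy t - E.r t * s :=
      (Continuous.tendsto (by fun_prop : Continuous fun s => E.cy t - E.r t * s) 0).eventually
        (lt_mem_nhds (by simpa using hy))
    have e2 : ∀ᶠ s in 𝓝 (0 : ℝ), 0 < 1 + s :=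
      (Continuous.tendsto (by fun_prop : Continuous fun s : ℝ => 1 + s) 0).eventually
        (lt_mem_nhds (by simp))
    filter_upwards [e1, e2] with s h1 h2
    have := hE.optimal t _ _ (1 + s) 1 ⟨h1, hz, h2, by linarith, by linarith⟩
    simpa [hE.rental_clearing] using this
  have h0 := hmax.hasDerivAt_eq_zero hd
  have hcpos := Real.rpow_pos_of_pos (hc.pos _ _ hy hz) γ
  simp only [mul_zero, sub_zero, add_zero, mul_one, zero_mul] at h0
  field_simp at h0
  linarith

theorem IsEquilibrium.cy_eq (hγ₁ : γ < 1) (hc : IsCompositeConsumption c)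
    (hE : E.IsEquilibrium (utility γ c v) ey eo) (t : ℕ) : E.cy t = ey t - E.S t := by
  obtain ⟨hy, hz, hh, hb1, hb2⟩ := hE.budget t
  rw [hE.rental_clearing, hE.housing_clearing] at hb1
  rw [hE.housing_clearing] at hb2
  by_contra hne
  have hlt : E.cy t < ey t - E.S t := lt_of_le_of_ne (by rw [S]; linarith) hne
  have h1 := hE.optimal t (ey t - E.S t) (E.co (t + 1)) 1 1
    ⟨hy.trans hlt, hz, one_pos, by rw [S]; linarith, hb2⟩
  rw [hE.rental_clearing] at h1
  exact absurd (utility_lt_utility hγ₁ hc hy hz (hc.lt_of_lt_left hy hlt hz)) h1.not_gt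

theorem IsEquilibrium.co_eq (hγ₁ : γ < 1) (hc : IsCompositeConsumption c)
    (hE : E.IsEquilibrium (utility γ c v) ey eo) (t : ℕ) : E.co t = eo t + E.S t := by
  have h1 := hE.commodity_clearing t
  have h2 := hE.cy_eq hγ₁ hc t
  linarith

theorem IsEquilibrium.rent_pos (hγ₁ : γ < 1) (hc : IsCompositeConsumption c)
    (hv : IsHousingUtility γ c v) (hE : E.IsEquilibrium (utility γ c v) ey eo) (t : ℕ) :
    0 < E.r t := by
  obtain ⟨hy, hz, -⟩ := hE.budget t
  have h1 := hE.rent_mul_partialY hγ₁ hc hv t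
  have h2 := Real.rpow_pos_of_pos (hc.pos _ _ hy hz) γ
  exact pos_of_mul_pos_left (h1 ▸ mul_pos (hv.deriv_pos 1 one_pos) h2)
    (hc.partialY_pos _ _ hy hz).le

theorem IsEquilibrium.S_pos (hγ₁ : γ < 1) (hc : IsCompositeConsumption c)
    (hv : IsHousingUtility γ c v) (hE : E.IsEquilibrium (utility γ c v) ey eo) (t : ℕ) :
    0 < E.S t :=
  add_pos_of_nonneg_of_pos (hE.price_nonneg t) (hE.rent_pos hγ₁ hc hv t)

theorem IsEquilibrium.price_pos (hγ₁ : γ < 1) (hc : IsCompositeConsumption c)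
    (hv : IsHousingUtility γ c v) (hE : E.IsEquilibrium (utility γ c v) ey eo) (t : ℕ) :
    0 < E.P t := by
  obtain ⟨hy, hz, -⟩ := hE.budget t
  exact pos_of_mul_pos_left (hE.price_mul_partialY hγ₁ hc hv t ▸
    mul_pos (hE.S_pos hγ₁ hc hv _) (hc.partialZ_pos _ _ hy hz)) (hc.partialY_pos _ _ hy hz).le

theorem IsEquilibrium.r_eq (hγ₁ : γ < 1) (hc : IsCompositeConsumption c)
    (hv : IsHousingUtility γ c v) (hE : E.IsEquilibrium (utility γ c v) ey eo) (t : ℕ) :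
    E.r t = housingMRS γ (deriv v 1) c (E.cy t) (E.co (t + 1)) := by
  obtain ⟨hy, hz, -⟩ := hE.budget t
  rw [housingMRS, eq_div_iff (hc.partialY_pos _ _ hy hz).ne', hE.rent_mul_partialY hγ₁ hc hv t]

theorem IsEquilibrium.isEulerPath (hγ₁ : γ < 1) (hc : IsCompositeConsumption c)
    (hv : IsHousingUtility γ c v) (hE : E.IsEquilibrium (utility γ c v) ey eo) :
    IsEulerPath γ (deriv v 1) c ey eo E.S := by
  refine ⟨hE.S_pos hγ₁ hc hv, fun t => ?_, fun t => ?_⟩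
  · have h1 := (hE.budget t).1
    rw [hE.cy_eq hγ₁ hc] at h1
    exact sub_pos.1 h1
  · rw [← hE.cy_eq hγ₁ hc, ← hE.co_eq hγ₁ hc, ← hE.price_mul_partialY hγ₁ hc hv,
      ← hE.rent_mul_partialY hγ₁ hc hv, S, add_mul]

/-- The gross interest rate is the marginal rate of substitution. -/
theorem IsEquilibrium.R_eq (hγ₁ : γ < 1) (hc : IsCompositeConsumption c)
    (hv : IsHousingUtility γ c v) (hE : E.IsEquilibrium (utility γ c v) ey eo) (t : ℕ) :
    E.R t = mrs c (E.cy t) (E.co (t + 1)) := by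
  obtain ⟨hy, hz, -⟩ := hE.budget t
  rw [R, mrs, div_eq_div_iff (hE.price_pos hγ₁ hc hv t).ne' (hc.partialZ_pos _ _ hy hz).ne',
    mul_comm (partialY _ _ _), hE.price_mul_partialY hγ₁ hc hv t, S]

end PriceAllocation

/-- For a quasi-concave utility the first-order conditions are sufficient: a bundle that costs no
more than `(y₀, z₀, h₀)` at the prices given by the gradient at `(y₀, z₀, h₀)` is not
preferred to it. -/
theorem utility_le_of_gradient_le (hγ₁ : γ < 1) (hc : IsCompositeConsumption c)
    (hv : IsHousingUtility γ c v) {y₀ z₀ h₀ y z h : ℝ} (hy₀ : 0 < y₀) (hz₀ : 0 < z₀) (hh₀ : 0 < h₀)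
    (hy : 0 < y) (hz : 0 < z) (hh : 0 < h)
    (hle : (c y₀ z₀ ^ γ)⁻¹ * ((y - y₀) * partialY c y₀ z₀ + (z - z₀) * partialZ c y₀ z₀) +
      deriv v h₀ * (h - h₀) ≤ 0) :
    utility γ c v y z h ≤ utility γ c v y₀ z₀ h₀ := by
  by_contra! hlt
  -- Lowering `y` slightly makes the bundle strictly cheaper and still preferred.
  obtain ⟨y', hy'y, hy', hlt'⟩ : ∃ y' < y, 0 < y' ∧
      utility γ c v y₀ z₀ h₀ < utility γ c v y' z h := by
    have hd := hasDerivAt_utility (f := fun y => y) (g := fun _ => z) (k := fun _ => h) hγ₁ hc hv hy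
      hz hh (hasDerivAt_id y) (hasDerivAt_const y z) (hasDerivAt_const y h)
    have e1 := (hd.continuousAt.tendsto.eventually (lt_mem_nhds hlt)).filter_mono
      (nhdsWithin_le_nhds (s := Iio y))
    have e2 := (lt_mem_nhds hy).filter_mono (nhdsWithin_le_nhds (s := Iio y))
    obtain ⟨y', h1, h2, h3⟩ := (e1.and (e2.and self_mem_nhdsWithin)).exists
    exact ⟨y', h3, h2, h1⟩
  have hneg : (c y₀ z₀ ^ γ)⁻¹ * ((y' - y₀) * partialY c y₀ z₀ + (z - z₀) * partialZ c y₀ z₀) +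
      deriv v h₀ * (h - h₀) < 0 := by
    refine lt_of_lt_of_le ?_ hle
    have h1 := hc.partialY_pos _ _ hy₀ hz₀
    have h2 := Real.rpow_pos_of_pos (hc.pos _ _ hy₀ hz₀) γ
    gcongr
  have hd := hasDerivAt_utility (f := fun s => y₀ + (y' - y₀) * s)
    (g := fun s => z₀ + (z - z₀) * s) (k := fun s => h₀ + (h - h₀) * s) (s := 0) hγ₁ hc hv
    (by simpa using hy₀) (by simpa using hz₀) (by simpa using hh₀)
    (((hasDerivAt_id (0 : ℝ)).const_mul (y' - y₀)).const_add y₀)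
    (((hasDerivAt_id (0 : ℝ)).const_mul (z - z₀)).const_add z₀)
    (((hasDerivAt_id (0 : ℝ)).const_mul (h - h₀)).const_add h₀)
  simp only [mul_zero, add_zero, mul_one] at hd
  have hslope := hd.tendsto_slope_zero_right
  have e1 := hslope.eventually (gt_mem_nhds hneg)
  have e2 : ∀ᶠ s : ℝ in 𝓝[>] 0, s ∈ Ioo (0 : ℝ) 1 := Ioo_mem_nhdsGT one_pos
  obtain ⟨s, h1, hs0, hs1⟩ := (e1.and e2).exists
  have hne : ((y₀, z₀, h₀) : ℝ × ℝ × ℝ) ≠ (y', z, h) := by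
    intro heq
    simp only [Prod.mk.injEq] at heq
    obtain ⟨rfl, rfl, rfl⟩ := heq
    exact lt_irrefl _ hlt'
  have hq := hv.strictQuasiconcave.2 (y₀, z₀, h₀) ⟨hy₀, hz₀, hh₀⟩ (y', z, h) ⟨hy', hz, hh⟩ hne
    (1 - s) s (by linarith) hs0 (by ring)
  simp only [Prod.smul_mk, smul_eq_mul, Prod.mk_add_mk] at hq
  rw [min_eq_left hlt'.le] at hq
  have e3 : ∀ a b : ℝ, (1 - s) * a + s * b = a + (b - a) * s := fun a b => by ring
  rw [e3, e3, e3] at hq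
  have h2 : 0 < s⁻¹ := inv_pos.2 hs0
  simp only [zero_add, mul_zero, add_zero, smul_eq_mul] at h1
  nlinarith [mul_pos h2 (sub_pos.2 hq)]

/-- The equilibrium candidate generated by a sequence of housing expenditures. -/
def eulerAllocation (γ m : ℝ) (c : ℝ → ℝ → ℝ) (ey eo S : ℕ → ℝ) : PriceAllocation where
  P t := S t - housingMRS γ m c (ey t - S t) (eo (t + 1) + S (t + 1))
  r t := housingMRS γ m c (ey t - S t) (eo (t + 1) + S (t + 1))
  cy t := ey t - S t
  co t := eo t + S t
  h _ := 1
  x _ := 1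

theorem eulerAllocation_S {m : ℝ} {S : ℕ → ℝ} : (eulerAllocation γ m c ey eo S).S = S := by
  funext t
  simp [PriceAllocation.S, eulerAllocation]

theorem IsEulerPath.isEquilibrium (hγ₁ : γ < 1) (hc : IsCompositeConsumption c)
    (hv : IsHousingUtility γ c v) (heo : ∀ t, 0 < eo t) {S : ℕ → ℝ}
    (hS : IsEulerPath γ (deriv v 1) c ey eo S) :
    (eulerAllocation γ (deriv v 1) c ey eo S).IsEquilibrium (utility γ c v) ey eo := by
  set E := eulerAllocation γ (deriv v 1) c ey eo S with hEdef
  have hES : ∀ t, E.P t + E.r t = S t := fun t => congrFun eulerAllocation_S t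
  have hy : ∀ t, 0 < ey t - S t := fun t => sub_pos.2 (hS.lt t)
  have hz : ∀ t, 0 < eo (t + 1) + S (t + 1) := fun t => add_pos (heo _) (hS.pos _)
  have hr : ∀ t, E.r t * partialY c (ey t - S t) (eo (t + 1) + S (t + 1)) =
      deriv v 1 * c (ey t - S t) (eo (t + 1) + S (t + 1)) ^ γ :=
    fun t => div_mul_cancel₀ _ (hc.partialY_pos _ _ (hy t) (hz t)).ne'
  have hP : ∀ t, E.P t * partialY c (ey t - S t) (eo (t + 1) + S (t + 1)) =
      S (t + 1) * partialZ c (ey t - S t) (eo (t + 1) + S (t + 1)) := fun t => by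
    have h1 := hS.euler t
    have h2 := hr t
    have h3 := hES t
    linear_combination h1 - h2 +
      h3 * partialY c (ey t - S t) (eo (t + 1) + S (t + 1))
  have hcp : ∀ t, 0 < c (ey t - S t) (eo (t + 1) + S (t + 1)) ^ γ :=
    fun t => Real.rpow_pos_of_pos (hc.pos _ _ (hy t) (hz t)) _
  refine ⟨fun t => ?_, fun t => ?_, fun t => ?_, fun t y z h x hb => ?_, fun t => ?_,
    fun _ => rfl, fun _ => rfl⟩
  · exact nonneg_of_mul_nonneg_left (hP t ▸ (mul_pos (hS.pos _)
      (hc.partialZ_pos _ _ (hy t) (hz t))).le) (hc.partialY_pos _ _ (hy t) (hz t))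
  · exact (div_pos (mul_pos (hv.deriv_pos 1 one_pos) (hcp t))
      (hc.partialY_pos _ _ (hy t) (hz t))).le
  · refine ⟨hy t, hz t, one_pos, ?_, ?_⟩
    · change ey t - S t + E.P t * 1 + E.r t * 1 ≤ ey t
      linarith [hES t]
    · change eo (t + 1) + S (t + 1) ≤ eo (t + 1) + (E.P (t + 1) + E.r (t + 1)) * 1
      linarith [hES (t + 1)]
  · obtain ⟨hy', hz', hh', hb1, hb2⟩ := hb
    refine utility_le_of_gradient_le hγ₁ hc hv (hy t) (hz t) one_pos hy' hz' hh' ?_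
    have hY := hc.partialY_pos _ _ (hy t) (hz t)
    have hZ := hc.partialZ_pos _ _ (hy t) (hz t)
    have hm : deriv v 1 = (c (ey t - S t) (eo (t + 1) + S (t + 1)) ^ γ)⁻¹ *
        (E.r t * partialY c (ey t - S t) (eo (t + 1) + S (t + 1))) := by
      rw [hr t]; field_simp [(hcp t).ne']
    change (c (ey t - S t) (eo (t + 1) + S (t + 1)) ^ γ)⁻¹ *
      ((y - (ey t - S t)) * partialY c (ey t - S t) (eo (t + 1) + S (t + 1)) +
      (z - (eo (t + 1) + S (t + 1))) * partialZ c (ey t - S t) (eo (t + 1) + S (t + 1))) +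
      deriv v 1 * (h - 1) ≤ 0
    rw [hm, mul_assoc, ← mul_add]
    refine mul_nonpos_of_nonneg_of_nonpos (inv_pos.2 (hcp t)).le ?_
    rw [hES] at hb2
    have e1 : y - (ey t - S t) ≤ -(E.P t * (x - 1)) - E.r t * (h - 1) := by
      linarith [hES t]
    have e2 : z - (eo (t + 1) + S (t + 1)) ≤ S (t + 1) * (x - 1) := by linarith
    have e3 := mul_le_mul_of_nonneg_right e1 hY.le
    have e4 := mul_le_mul_of_nonneg_right e2 hZ.le
    linear_combination e3 + e4 - (x - 1) * hP t
  · change ey t - S t + (eo t + S t) = ey t + eo t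
    ring

end

/-! ### Present values and bubbles -/

noncomputable section

namespace PriceAllocation

variable {E : PriceAllocation}

theorem R_pos (hP : ∀ t, 0 < E.P t) (hr : ∀ t, 0 ≤ E.r t) (t : ℕ) : 0 < E.R t :=
  div_pos (add_pos_of_pos_of_nonneg (hP _) (hr _)) (hP t)

theorem q_pos (hP : ∀ t, 0 < E.P t) (hr : ∀ t, 0 ≤ E.r t) (t : ℕ) : 0 < E.q t :=
  one_div_pos.2 (Finset.prod_pos fun s _ => R_pos hP hr s)

theorem q_succ_mul_R (hP : ∀ t, 0 < E.P t) (hr : ∀ t, 0 ≤ E.r t) (t : ℕ) :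
    E.q (t + 1) * E.R t = E.q t := by
  have h1 := (R_pos hP hr t).ne'
  rw [q, q, Finset.prod_range_succ]
  field_simp

/-- Absence of arbitrage: the present value of housing at `t` is that of its price and rent at
`t + 1`. -/
theorem q_mul_P (hP : ∀ t, 0 < E.P t) (hr : ∀ t, 0 ≤ E.r t) (t : ℕ) :
    E.q t * E.P t = E.q (t + 1) * E.P (t + 1) + E.q (t + 1) * E.r (t + 1) := by
  rw [← q_succ_mul_R hP hr t, R, mul_assoc, div_mul_cancel₀ _ (hP t).ne']
  ring

theorem sum_q_mul_r (hP : ∀ t, 0 < E.P t) (hr : ∀ t, 0 ≤ E.r t) (t n : ℕ) :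
    ∑ k ∈ Finset.range n, E.q (t + 1 + k) * E.r (t + 1 + k) =
      E.q t * E.P t - E.q (t + n) * E.P (t + n) := by
  induction n with
  | zero => simp
  | succ n ih =>
    rw [Finset.sum_range_succ, ih, q_mul_P hP hr (t + n)]
    have : t + 1 + n = t + n + 1 := by ring
    have h' : t + (n + 1) = t + n + 1 := by ring
    rw [this, h']
    ring

/-- The present value `q t * P t` of the resale price has a limit `L ≥ 0`, and the bubble
`P t - V t` is worth `L` at date `0`. -/
theorem exists_tendsto_q_mul_P (hP : ∀ t, 0 < E.P t) (hr : ∀ t, 0 ≤ E.r t) :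
    ∃ L : ℝ, 0 ≤ L ∧ Tendsto (fun t => E.q t * E.P t) atTop (𝓝 L) ∧
      Summable (fun t => E.q t * E.r t) ∧ ∀ t, E.P t - E.V t = L / E.q t := by
  have hpos : ∀ t, 0 < E.q t * E.P t := fun t => mul_pos (q_pos hP hr t) (hP t)
  have hanti : Antitone fun t => E.q t * E.P t := antitone_nat_of_succ_le fun t => by
    rw [q_mul_P hP hr t]
    linarith [mul_nonneg (q_pos hP hr (t + 1)).le (hr (t + 1))]
  have hbdd : BddBelow (range fun t => E.q t * E.P t) :=
    ⟨0, by rintro _ ⟨t, rfl⟩; exact (hpos t).le⟩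
  have hL := tendsto_atTop_ciInf hanti hbdd
  set L := ⨅ t, E.q t * E.P t
  have hsum : ∀ t, HasSum (fun k => E.q (t + 1 + k) * E.r (t + 1 + k)) (E.q t * E.P t - L) := by
    intro t
    rw [hasSum_iff_tendsto_nat_of_nonneg
      (fun k => mul_nonneg (q_pos hP hr _).le (hr _))]
    simp_rw [sum_q_mul_r hP hr]
    refine tendsto_const_nhds.sub ?_
    have := (tendsto_add_atTop_iff_nat t).2 hL
    exact this.congr fun n => by rw [add_comm]
  refine ⟨L, le_ciInf fun t => (hpos t).le, hL, ?_, fun t => ?_⟩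
  · rw [← summable_nat_add_iff 1]
    exact (hsum 0).summable.congr fun k => by rw [zero_add, add_comm]
  · have hq := (q_pos hP hr t).ne'
    rw [V, (hsum t).tsum_eq]
    field_simp
    ring

theorem IsFundamental.tendsto_q_mul_P (hP : ∀ t, 0 < E.P t) (hr : ∀ t, 0 ≤ E.r t)
    (hE : E.IsFundamental) : Tendsto (fun t => E.q t * E.P t) atTop (𝓝 0) := by
  obtain ⟨L, -, hL, -, hV⟩ := exists_tendsto_q_mul_P hP hr
  have h0 := hV 0
  rw [hE.2 0, sub_self, eq_comm, div_eq_zero_iff] at h0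
  rwa [h0.resolve_right (q_pos hP hr 0).ne'] at hL

theorem isFundamental_of_tendsto_q_mul_P (hP : ∀ t, 0 < E.P t) (hr : ∀ t, 0 ≤ E.r t)
    (h : Tendsto (fun t => E.q t * E.P t) atTop (𝓝 0)) : E.IsFundamental := by
  obtain ⟨L, -, hL, hs, hV⟩ := exists_tendsto_q_mul_P hP hr
  refine ⟨hs, fun t => ?_⟩
  have := hV t
  rw [tendsto_nhds_unique hL h, zero_div] at this
  linarith

/-- Bubble characterization: if the rent-price ratio is summable, then there is a bubble. -/
theorem isBubbly_of_summable (hP : ∀ t, 0 < E.P t) (hr : ∀ t, 0 ≤ E.r t)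
    (h : Summable fun t => E.r t / E.P t) : E.IsBubbly := by
  obtain ⟨L, -, hL, hs, hV⟩ := exists_tendsto_q_mul_P hP hr
  have hnn : ∀ t, 0 ≤ E.r t / E.P t := fun t => div_nonneg (hr t) (hP t).le
  have hlow : ∀ t, E.q 0 * E.P 0 ≤
      E.q t * E.P t * Real.exp (∑ s ∈ Finset.range (t + 1), E.r s / E.P s) := by
    intro t
    induction t with
    | zero =>
      exact le_mul_of_one_le_right (mul_pos (q_pos hP hr 0) (hP 0)).le
        (Real.one_le_exp (Finset.sum_nonneg fun s _ => hnn s))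
    | succ t ih =>
      refine ih.trans ?_
      rw [Finset.sum_range_succ _ (t + 1), Real.exp_add, mul_comm (Real.exp _) (Real.exp _),
        ← mul_assoc]
      refine mul_le_mul_of_nonneg_right ?_ (Real.exp_pos _).le
      rw [q_mul_P hP hr t]
      have h1 : E.r (t + 1) / E.P (t + 1) + 1 ≤ Real.exp (E.r (t + 1) / E.P (t + 1)) :=
        Real.add_one_le_exp _
      have h2 := mul_pos (q_pos hP hr (t + 1)) (hP (t + 1))
      have h3 : E.q (t + 1) * E.P (t + 1) * (E.r (t + 1) / E.P (t + 1)) =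
          E.q (t + 1) * E.r (t + 1) := by
        have := (hP (t + 1)).ne'
        field_simp
      nlinarith [mul_le_mul_of_nonneg_left h1 h2.le]
  set B := ∑' s, E.r s / E.P s
  have hlow' : ∀ t, E.q 0 * E.P 0 ≤ E.q t * E.P t * Real.exp B := fun t =>
    (hlow t).trans (mul_le_mul_of_nonneg_left
      (Real.exp_le_exp.2 (h.sum_le_tsum _ fun s _ => hnn s))
      (mul_pos (q_pos hP hr t) (hP t)).le)
  have h1 : E.q 0 * E.P 0 ≤ L * Real.exp B :=
    ge_of_tendsto' (hL.mul_const _) hlow'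
  have hLpos : 0 < L := pos_of_mul_pos_left
    ((mul_pos (q_pos hP hr 0) (hP 0)).trans_le h1) (Real.exp_pos _).le
  exact ⟨hs, fun t => sub_pos.1 (hV t ▸ div_pos hLpos (q_pos hP hr t))⟩

end PriceAllocation

end

/-! ### Growth of housing expenditure along solutions of the Euler equation -/

noncomputable section

variable {γ m : ℝ} {c : ℝ → ℝ → ℝ}

namespace IsCompositeConsumption

theorem housingMRS_pos (hm : 0 < m) (hc : IsCompositeConsumption c) {y z : ℝ} (hy : 0 < y)
    (hz : 0 < z) : 0 < housingMRS γ m c y z :=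
  div_pos (mul_pos hm (Real.rpow_pos_of_pos (hc.pos _ _ hy hz) _)) (hc.partialY_pos _ _ hy hz)

theorem housingMRS_homogeneous (hc : IsCompositeConsumption c) {k y z : ℝ} (hk : 0 < k)
    (hy : 0 < y) (hz : 0 < z) :
    housingMRS γ m c (k * y) (k * z) = k ^ γ * housingMRS γ m c y z := by
  rw [housingMRS, hc.homogeneous k y z hk hy hz, hc.partialY_homogeneous hk hy hz,
    Real.mul_rpow hk.le (hc.pos y z hy hz).le, housingMRS]
  ring

theorem housingMRS_le (hγ₀ : 0 < γ) (hm : 0 < m) (hc : IsCompositeConsumption c)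
    {y Y z z₀ Z : ℝ} (hy : 0 < y) (hyY : y ≤ Y) (hz₀ : 0 < z₀) (hz : z₀ ≤ z) (hzZ : z ≤ Z) :
    housingMRS γ m c y z ≤ m * c Y Z ^ γ / partialY c Y z₀ := by
  have hz' := hz₀.trans_le hz
  refine div_le_div₀ (mul_pos hm (Real.rpow_pos_of_pos
    (hc.pos _ _ (hy.trans_le hyY) (hz'.trans_le hzZ)) _)).le ?_
    (hc.partialY_pos _ _ (hy.trans_le hyY) hz₀) (hc.partialY_mono hy hyY hz₀ hz)
  exact mul_le_mul_of_nonneg_left (Real.rpow_le_rpow (hc.pos _ _ hy hz').le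
    (hc.mono hy hyY hz' hzZ) hγ₀.le) hm.le

theorem le_housingMRS (hγ₀ : 0 < γ) (hm : 0 < m) (hc : IsCompositeConsumption c)
    {y y₀ z z₀ Z : ℝ} (hy₀ : 0 < y₀) (hy : y₀ ≤ y) (hz₀ : 0 < z₀) (hz : z₀ ≤ z) (hzZ : z ≤ Z) :
    m * c y₀ z₀ ^ γ / partialY c y₀ Z ≤ housingMRS γ m c y z := by
  have hz' := hz₀.trans_le hz
  refine div_le_div₀ (mul_pos hm (Real.rpow_pos_of_pos
    (hc.pos _ _ (hy₀.trans_le hy) hz') _)).le ?_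
    (hc.partialY_pos _ _ (hy₀.trans_le hy) hz') (hc.partialY_mono hy₀ hy hz' hzZ)
  exact mul_le_mul_of_nonneg_left (Real.rpow_le_rpow (hc.pos _ _ hy₀ hz₀).le
    (hc.mono hy₀ hy hz₀ hz) hγ₀.le) hm.le

end IsCompositeConsumption

namespace IsEulerPath

variable {ey eo S : ℕ → ℝ} {G e₁ e₂ : ℝ} {T t : ℕ}

theorem cons_young_pos (hS : IsEulerPath γ m c ey eo S) (t : ℕ) : 0 < ey t - S t :=
  sub_pos.2 (hS.lt t)

theorem cons_young_eq (hG : 1 < G)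
    (hT : ∀ t, T ≤ t → ey t = e₁ * G ^ t ∧ eo t = e₂ * G ^ t) (ht : T ≤ t) :
    ey t - S t = G ^ t * (e₁ - S t / G ^ t) := by
  have : G ^ t ≠ 0 := by positivity
  rw [(hT t ht).1]
  field_simp

theorem cons_old_eq (hG : 1 < G)
    (hT : ∀ t, T ≤ t → ey t = e₁ * G ^ t ∧ eo t = e₂ * G ^ t) (ht : T ≤ t) :
    eo (t + 1) + S (t + 1) = G ^ t * (G * (e₂ + S (t + 1) / G ^ (t + 1))) := by
  have : G ≠ 0 := by positivity
  rw [(hT (t + 1) (by omega)).2, pow_succ]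
  field_simp

theorem detrended_lt (hG : 1 < G) (hS : IsEulerPath γ m c ey eo S)
    (hT : ∀ t, T ≤ t → ey t = e₁ * G ^ t ∧ eo t = e₂ * G ^ t) (ht : T ≤ t) :
    S t / G ^ t < e₁ := by
  rw [div_lt_iff₀ (by positivity), ← (hT t ht).1]
  exact hS.lt t

theorem detrended_pos (hG : 1 < G) (hS : IsEulerPath γ m c ey eo S) (t : ℕ) : 0 < S t / G ^ t :=
  div_pos (hS.pos t) (by positivity)

/-- The Euler equation solved for current housing expenditure. -/
theorem eq_add_housingMRS (hc : IsCompositeConsumption c) (heo : ∀ t, 0 < eo t)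
    (hS : IsEulerPath γ m c ey eo S) (t : ℕ) :
    S t = S (t + 1) / mrs c (ey t - S t) (eo (t + 1) + S (t + 1)) +
      housingMRS γ m c (ey t - S t) (eo (t + 1) + S (t + 1)) := by
  have h1 := hc.partialY_pos _ _ (hS.cons_young_pos t) (add_pos (heo (t + 1)) (hS.pos (t + 1)))
  rw [mrs, housingMRS, div_div_eq_mul_div, ← add_div, eq_div_iff h1.ne', hS.euler t]

end IsEulerPath

/-- The rent grows at most like `G ^ (γ t)`, whatever the housing price. -/
theorem housingMRS_le_mul_pow (hγ₀ : 0 < γ) (hm : 0 < m) (hc : IsCompositeConsumption c)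
    {ey eo : ℕ → ℝ} {G e₁ e₂ : ℝ} {T : ℕ} (hG : 1 < G) (he₁ : 0 < e₁) (he₂ : 0 < e₂)
    (hT : ∀ t, T ≤ t → ey t = e₁ * G ^ t ∧ eo t = e₂ * G ^ t) :
    ∃ B > 0, ∀ t, T ≤ t → ∀ s s', 0 ≤ s → s < ey t → 0 ≤ s' → s' ≤ ey (t + 1) →
      housingMRS γ m c (ey t - s) (eo (t + 1) + s') ≤ B * (G ^ γ) ^ t := by
  have hG0 : 0 < G := by positivity
  refine ⟨m * c e₁ (G * (e₁ + e₂)) ^ γ / partialY c e₁ (G * e₂), ?_, ?_⟩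
  · exact div_pos (mul_pos hm (Real.rpow_pos_of_pos (hc.pos _ _ he₁ (by positivity)) _))
      (hc.partialY_pos _ _ he₁ (by positivity))
  · intro t ht s s' hs hs1 hs' hs1'
    have h1 := (hT t ht).1
    have h2 := hT (t + 1) (by omega)
    have hGt : 0 < G ^ t := by positivity
    have h3 := hc.housingMRS_le (γ := γ) (Y := G ^ t * e₁) (z₀ := G ^ t * (G * e₂))
      (Z := G ^ t * (G * (e₁ + e₂))) hγ₀ hm (sub_pos.2 hs1) (by rw [h1]; linarith)
      (by positivity) (z := eo (t + 1) + s')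
      (by rw [h2.2, pow_succ]; linarith)
      (by rw [h2.1, pow_succ] at hs1'; rw [h2.2, pow_succ]; linarith)
    refine h3.trans_eq ?_
    rw [hc.homogeneous _ _ _ hGt he₁ (by positivity),
      hc.partialY_homogeneous hGt he₁ (by positivity),
      Real.mul_rpow hGt.le (hc.pos _ _ he₁ (by positivity)).le, Real.rpow_pow_comm hG0.le]
    ring

/-- Suppose that the interest rate `mrs c e₁ (G e₂)` at which agents consume their endowments is
below `G ^ γ`. Then housing expenditure cannot be small relative to the endowment at any date:
otherwise it would stay small and grow at a rate below `G ^ γ`, and fall short of the rent, which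
then grows like `G ^ (γ t)`. -/
theorem IsEulerPath.exists_mul_pow_le (hγ₀ : 0 < γ) (hγ₁ : γ < 1) (hm : 0 < m)
    (hc : IsCompositeConsumption c)
    {ey eo S : ℕ → ℝ} {G e₁ e₂ : ℝ} {T : ℕ} (hG : 1 < G) (he₁ : 0 < e₁) (he₂ : 0 < e₂)
    (heo : ∀ t, 0 < eo t) (hT : ∀ t, T ≤ t → ey t = e₁ * G ^ t ∧ eo t = e₂ * G ^ t)
    (hS : IsEulerPath γ m c ey eo S) (hlt : mrs c e₁ (G * e₂) < G ^ γ) :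
    ∃ δ > 0, ∀ t, T ≤ t → δ * G ^ t ≤ S t := by
  have hG0 : 0 < G := by positivity
  have hgG : G ^ γ < G := by simpa using Real.rpow_lt_rpow_of_exponent_lt hG hγ₁
  set K := mrs c (e₁ / 2) (G * (e₂ + e₁))
  have hK : 0 < K := hc.mrs_pos (by positivity) (by positivity)
  obtain ⟨δ, hδ, hδ2, hδ'⟩ : ∃ δ, 0 < δ ∧ δ < e₁ / 2 ∧
      mrs c (e₁ - δ) (G * e₂ + K * δ) < G ^ γ := by
    have h1 : Tendsto (fun δ => mrs c (e₁ - δ) (G * e₂ + K * δ)) (𝓝[>] 0)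
        (𝓝 (mrs c e₁ (G * e₂))) := by
      refine tendsto_comp_of_continuousOn_posQuadrant hc.continuousOn_mrs he₁ (by positivity) ?_ ?_
      · exact ((by fun_prop : Continuous fun δ => e₁ - δ).tendsto' 0 _ (by simp)).mono_left
          nhdsWithin_le_nhds
      · exact ((by fun_prop : Continuous fun δ => G * e₂ + K * δ).tendsto' 0 _
          (by simp)).mono_left nhdsWithin_le_nhds
    have h2 : ∀ᶠ δ : ℝ in 𝓝[>] 0, δ ∈ Ioo 0 (e₁ / 2) := Ioo_mem_nhdsGT (by positivity)
    obtain ⟨δ, h3, h4, h5⟩ := ((h1.eventually (gt_mem_nhds hlt)).and h2).exists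
    exact ⟨δ, h4, h5, h3⟩
  set lam := mrs c (e₁ - δ) (G * e₂ + K * δ)
  have hlam : 0 < lam := hc.mrs_pos (by linarith) (by positivity)
  refine ⟨δ, hδ, ?_⟩
  by_contra! hsmall
  obtain ⟨N, hN, hSN⟩ := hsmall
  have hstep : ∀ t, T ≤ t → S t ≤ δ * G ^ t → S (t + 1) ≤ lam * S t := by
    intro t ht hst
    have hGt : 0 < G ^ t := by positivity
    have hx : S t / G ^ t ≤ δ := (div_le_iff₀ hGt).2 hst
    have hx0 := hS.detrended_pos hG t
    have hx'0 := hS.detrended_pos hG (t + 1)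
    have hx'1 := hS.detrended_lt hG hT (t := t + 1) (by omega)
    have heq := hS.eq_add_housingMRS hc heo t
    have hrent := hc.housingMRS_pos (γ := γ) hm (hS.cons_young_pos t)
      (add_pos (heo (t + 1)) (hS.pos (t + 1)))
    have hmrs := hc.mrs_pos (hS.cons_young_pos t) (add_pos (heo (t + 1)) (hS.pos (t + 1)))
    have hle : S (t + 1) ≤ mrs c (ey t - S t) (eo (t + 1) + S (t + 1)) * S t := by
      rw [mul_comm, ← div_le_iff₀ hmrs]
      linarith
    rw [cons_young_eq hG hT ht, cons_old_eq hG hT ht,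
      hc.mrs_homogeneous hGt (by linarith) (by positivity)] at hle
    -- A crude bound on the expenditure at `t + 1`, which then gives the sharp rate `lam`.
    have hK' : mrs c (e₁ - S t / G ^ t) (G * (e₂ + S (t + 1) / G ^ (t + 1))) ≤ K :=
      hc.mrs_mono (by positivity) (by linarith) (by positivity) (by gcongr)
    have h1 : G * (S (t + 1) / G ^ (t + 1)) ≤ K * δ := by
      have h2 : S (t + 1) ≤ K * (δ * G ^ t) :=
        hle.trans (mul_le_mul hK' hst (hS.pos t).le hK.le)
      rw [pow_succ]
      have h3 : G * (S (t + 1) / (G ^ t * G)) = S (t + 1) / G ^ t := by field_simp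
      rw [h3, div_le_iff₀ hGt]
      linarith
    have hlam' : mrs c (e₁ - S t / G ^ t) (G * (e₂ + S (t + 1) / G ^ (t + 1))) ≤ lam :=
      hc.mrs_mono (by linarith) (by linarith) (by positivity) (by linarith)
    exact hle.trans (mul_le_mul_of_nonneg_right hlam' (hS.pos t).le)
  have hind : ∀ k, S (N + k) ≤ δ * G ^ (N + k) ∧ S (N + k) ≤ lam ^ k * S N := by
    intro k
    induction k with
    | zero => simpa using hSN.le
    | succ k ih =>
      have h1 := hstep (N + k) (by omega) ih.1
      refine ⟨?_, ?_⟩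
      · calc S (N + (k + 1)) ≤ lam * S (N + k) := h1
          _ ≤ G * (δ * G ^ (N + k)) :=
            mul_le_mul (hδ'.trans hgG).le ih.1 (hS.pos _).le hG0.le
          _ = δ * G ^ (N + (k + 1)) := by rw [← add_assoc, pow_succ]; ring
      · calc S (N + (k + 1)) ≤ lam * S (N + k) := h1
          _ ≤ lam * (lam ^ k * S N) := mul_le_mul_of_nonneg_left ih.2 hlam.le
          _ = lam ^ (k + 1) * S N := by rw [pow_succ]; ring
  set b := m * c (e₁ / 2) (G * e₂) ^ γ / partialY c (e₁ / 2) (G * (e₂ + e₁))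
  have hb : 0 < b := div_pos (mul_pos hm (Real.rpow_pos_of_pos
    (hc.pos _ _ (by positivity) (by positivity)) _))
    (hc.partialY_pos _ _ (by positivity) (by positivity))
  have hlow : ∀ k, b * (G ^ γ) ^ (N + k) ≤ S (N + k) := by
    intro k
    have ht : T ≤ N + k := by omega
    have hGt : 0 < G ^ (N + k) := by positivity
    have hx : S (N + k) / G ^ (N + k) ≤ δ := (div_le_iff₀ hGt).2 (hind k).1
    have hx'0 := hS.detrended_pos hG (N + k + 1)
    have hx'1 := hS.detrended_lt hG hT (t := N + k + 1) (by omega)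
    have heq := hS.eq_add_housingMRS hc heo (N + k)
    have hmrs := hc.mrs_pos (hS.cons_young_pos (N + k))
      (add_pos (heo (N + k + 1)) (hS.pos (N + k + 1)))
    have h1 := div_pos (hS.pos (N + k + 1)) hmrs
    have h2 : b ≤ housingMRS γ m c (e₁ - S (N + k) / G ^ (N + k))
        (G * (e₂ + S (N + k + 1) / G ^ (N + k + 1))) :=
      hc.le_housingMRS hγ₀ hm (by positivity) (by linarith) (by positivity)
        (by gcongr; linarith) (by gcongr)
    have h3 : housingMRS γ m c (ey (N + k) - S (N + k)) (eo (N + k + 1) + S (N + k + 1)) =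
        (G ^ γ) ^ (N + k) * housingMRS γ m c (e₁ - S (N + k) / G ^ (N + k))
        (G * (e₂ + S (N + k + 1) / G ^ (N + k + 1))) := by
      rw [cons_young_eq hG hT ht, cons_old_eq hG hT ht,
        hc.housingMRS_homogeneous hGt (by linarith) (by positivity), Real.rpow_pow_comm hG0.le]
    have h4 := mul_le_mul_of_nonneg_left h2 (by positivity : 0 ≤ (G ^ γ) ^ (N + k))
    linarith
  -- `(G ^ γ / lam) ^ k` would be bounded
  have hgrow : Tendsto (fun k : ℕ => (G ^ γ / lam) ^ k) atTop atTop :=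
    tendsto_pow_atTop_atTop_of_one_lt ((one_lt_div hlam).2 hδ')
  obtain ⟨k, hk⟩ := (hgrow.eventually (eventually_gt_atTop (S N / (b * (G ^ γ) ^ N)))).exists
  have h1 := (hlow k).trans (hind k).2
  rw [div_pow, div_lt_div_iff₀ (by positivity) (by positivity)] at hk
  rw [pow_add] at h1
  linarith

namespace PriceAllocation

variable {v : ℝ → ℝ} {ey eo : ℕ → ℝ} {E : PriceAllocation} {G e₁ e₂ : ℝ} {T : ℕ}

/-- The rent of an equilibrium grows at most like `G ^ (γ t)`. -/
theorem IsEquilibrium.exists_rent_le (hγ₀ : 0 < γ) (hγ₁ : γ < 1)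
    (hc : IsCompositeConsumption c) (hv : IsHousingUtility γ c v) (hG : 1 < G) (he₁ : 0 < e₁)
    (he₂ : 0 < e₂) (hT : ∀ t, T ≤ t → ey t = e₁ * G ^ t ∧ eo t = e₂ * G ^ t)
    (hE : E.IsEquilibrium (utility γ c v) ey eo) :
    ∃ B > 0, ∀ t, T ≤ t → E.r t ≤ B * (G ^ γ) ^ t := by
  obtain ⟨B, hB, h⟩ := housingMRS_le_mul_pow hγ₀ (hv.deriv_pos 1 one_pos) hc hG he₁ he₂ hT
  have hS := hE.isEulerPath hγ₁ hc hv
  refine ⟨B, hB, fun t ht => ?_⟩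
  rw [hE.r_eq hγ₁ hc hv, hE.cy_eq hγ₁ hc, hE.co_eq hγ₁ hc]
  exact h t ht _ _ (hS.pos _).le (hS.lt _) (hS.pos _).le (hS.lt _).le

/-- If housing expenditure is eventually at least a fixed fraction of the endowment, then so is the
housing price, because the rent grows more slowly; then the rent-price ratio is summable and there
is a bubble. -/
theorem IsEquilibrium.isBubbly_of_mul_pow_le (hγ₀ : 0 < γ) (hγ₁ : γ < 1)
    (hc : IsCompositeConsumption c) (hv : IsHousingUtility γ c v) (hG : 1 < G) (he₁ : 0 < e₁)
    (he₂ : 0 < e₂) (hT : ∀ t, T ≤ t → ey t = e₁ * G ^ t ∧ eo t = e₂ * G ^ t)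
    (hE : E.IsEquilibrium (utility γ c v) ey eo) {δ : ℝ} (hδ : 0 < δ)
    (hS : ∀ᶠ t in atTop, δ * G ^ t ≤ E.S t) :
    E.IsBubbly ∧ ∀ᶠ t in atTop, δ / 2 * G ^ t ≤ E.P t := by
  have hG0 : 0 < G := by positivity
  have hgG : G ^ γ < G := by simpa using Real.rpow_lt_rpow_of_exponent_lt hG hγ₁
  have hg0 : 0 < G ^ γ := Real.rpow_pos_of_pos hG0 _
  obtain ⟨B, hB, hr⟩ := hE.exists_rent_le hγ₀ hγ₁ hc hv hG he₁ he₂ hT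
  have hratio : G ^ γ / G < 1 := (div_lt_one hG0).2 hgG
  have hsmall : ∀ᶠ t : ℕ in atTop, (G ^ γ / G) ^ t < δ / 2 / B :=
    (tendsto_pow_atTop_nhds_zero_of_lt_one (by positivity) hratio).eventually
      (gt_mem_nhds (by positivity))
  have hP : ∀ᶠ t in atTop, δ / 2 * G ^ t ≤ E.P t := by
    filter_upwards [hS, hsmall, eventually_ge_atTop T] with t h1 h2 h3
    have h4 := hr t h3
    rw [div_pow, div_lt_div_iff₀ (by positivity) hB] at h2
    rw [S] at h1
    linarith
  refine ⟨isBubbly_of_summable (hE.price_pos hγ₁ hc hv)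
    (fun t => (hE.rent_pos hγ₁ hc hv t).le) ?_, hP⟩
  have hgeo : Summable fun t : ℕ => B / (δ / 2) * (G ^ γ / G) ^ t :=
    (summable_geometric_of_lt_one (by positivity) hratio).mul_left _
  refine summable_of_isBigO_nat hgeo (IsBigO.of_bound 1 ?_)
  filter_upwards [hP, eventually_ge_atTop T] with t h1 h2
  have h3 := hE.price_pos hγ₁ hc hv t
  have h4 := hE.rent_pos hγ₁ hc hv t
  rw [one_mul, Real.norm_of_nonneg (by positivity), Real.norm_of_nonneg (by positivity),
    div_pow, div_mul_div_comm]
  exact div_le_div₀ (by positivity) (hr t h2) (by positivity) h1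

end PriceAllocation

end

/-! ### Asymptotics of fundamental equilibria -/

noncomputable section

/-- A bounded solution of the forward-looking recursion `p t = μ t (p (t + 1) + ρ (t + 1))` with
`μ → a < 1` and `ρ → b` converges to the fixed point of `p = a (p + b)`. -/
theorem tendsto_of_forward_recursion {p μ ρ : ℕ → ℝ} {a b K : ℝ} (ha₀ : 0 ≤ a) (ha₁ : a < 1)
    (hμ : Tendsto μ atTop (𝓝 a)) (hρ : Tendsto ρ atTop (𝓝 b))
    (hp : ∀ t, p t = μ t * (p (t + 1) + ρ (t + 1))) (hb : ∀ᶠ t in atTop, |p t| ≤ K) :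
    Tendsto p atTop (𝓝 (a * b / (1 - a))) := by
  set L := a * b / (1 - a) with hL
  have hfix : a * (L + b) = L := by
    have : 1 - a ≠ 0 := by linarith
    rw [hL]; field_simp; ring
  obtain ⟨a', ha', ha'1⟩ := exists_between ha₁
  have ha'0 : 0 < a' := ha₀.trans_lt ha'
  have herr : Tendsto (fun t => μ t * (L + ρ (t + 1)) - L) atTop (𝓝 0) := by
    have h1 := (hμ.mul (tendsto_const_nhds.add ((tendsto_add_atTop_iff_nat 1).2 hρ) :
      Tendsto (fun t => L + ρ (t + 1)) atTop (𝓝 (L + b)))).sub_const L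
    rwa [hfix, sub_self] at h1
  have hμ' : ∀ᶠ t in atTop, |μ t| ≤ a' := by
    have h1 : Tendsto (fun t => |μ t|) atTop (𝓝 a) := by simpa [abs_of_nonneg ha₀] using hμ.abs
    exact (h1.eventually (gt_mem_nhds ha')).mono fun _ h => h.le
  rw [Metric.tendsto_atTop']
  intro ε hε
  have hε2 : 0 < ε / 2 * (1 - a') := mul_pos (half_pos hε) (sub_pos.2 ha'1)
  have herr' : ∀ᶠ t in atTop, |μ t * (L + ρ (t + 1)) - L| ≤ ε / 2 * (1 - a') := by
    have h1 : Tendsto (fun t => |μ t * (L + ρ (t + 1)) - L|) atTop (𝓝 0) := by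
      simpa using herr.abs
    exact (h1.eventually (gt_mem_nhds hε2)).mono fun _ h => h.le
  obtain ⟨N, hN⟩ := eventually_atTop.1 (hμ'.and (herr'.and hb))
  have hk : ∀ k : ℕ, ∀ t, N ≤ t → |p t - L| ≤ a' ^ k * (K + |L|) + ε / 2 := by
    intro k
    induction k with
    | zero =>
      intro t ht
      have h1 := abs_sub (p t) L
      have h2 := (hN t ht).2.2
      rw [pow_zero]
      linarith
    | succ k ih =>
      intro t ht
      have h1 : p t - L = μ t * (p (t + 1) - L) + (μ t * (L + ρ (t + 1)) - L) := by
        rw [hp t]; ring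
      obtain ⟨h2, h3, -⟩ := hN t ht
      have h4 : |μ t| * |p (t + 1) - L| ≤ a' * (a' ^ k * (K + |L|) + ε / 2) :=
        mul_le_mul h2 (ih (t + 1) (by omega)) (abs_nonneg _) ha'0.le
      calc |p t - L| ≤ |μ t| * |p (t + 1) - L| + |μ t * (L + ρ (t + 1)) - L| := by
            rw [h1, ← abs_mul]; exact abs_add_le _ _
        _ ≤ a' ^ (k + 1) * (K + |L|) + ε / 2 := by rw [pow_succ]; linarith
  refine ⟨N, fun t ht => ?_⟩
  have hlim : Tendsto (fun k : ℕ => a' ^ k * (K + |L|) + ε / 2) atTop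
      (𝓝 (0 * (K + |L|) + ε / 2)) :=
    ((tendsto_pow_atTop_nhds_zero_of_lt_one ha'0.le ha'1).mul_const _).add_const _
  have h1 := ge_of_tendsto' hlim fun k => hk k t ht.le
  rw [Real.dist_eq]
  linarith

namespace PriceAllocation

variable {γ : ℝ} {c : ℝ → ℝ → ℝ} {v : ℝ → ℝ} {ey eo : ℕ → ℝ} {E : PriceAllocation}
  {G e₁ e₂ : ℝ} {T : ℕ}

/-- If rents grow at most at the gross rate `g` and interest rates eventually exceed some
`ρ > g`, then a price without bubble grows at most at the gross rate `g`. -/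
theorem exists_price_le_mul_pow (hP : ∀ t, 0 < E.P t) (hr : ∀ t, 0 ≤ E.r t) {g ρ B : ℝ}
    (hg : 0 < g) (hρ : g < ρ) (hB : 0 ≤ B) (hrB : ∀ᶠ t in atTop, E.r t ≤ B * g ^ t)
    (hR : ∀ᶠ t in atTop, ρ ≤ E.R t) (hq : Tendsto (fun t => E.q t * E.P t) atTop (𝓝 0)) :
    ∃ K : ℝ, ∀ᶠ t in atTop, E.P t ≤ K * g ^ t := by
  obtain ⟨N, hN⟩ := eventually_atTop.1 (hrB.and hR)
  set K := B * g / (ρ - g) with hK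
  have hKB : K * (ρ - g) = B * g := div_mul_cancel₀ _ (sub_pos.2 hρ).ne'
  have hK0 : 0 ≤ K := div_nonneg (by positivity) (sub_pos.2 hρ).le
  have hstep : ∀ t, N ≤ t → E.q t * (E.P t - K * g ^ t) ≤
      E.q (t + 1) * (E.P (t + 1) - K * g ^ (t + 1)) := by
    intro t ht
    have h1 := (hN (t + 1) (by omega)).1
    have h2 := (hN t ht).2
    have h3 : E.r (t + 1) ≤ K * (E.R t - g) * g ^ t := by
      refine h1.trans ?_
      rw [pow_succ, mul_comm (g ^ t) g, ← mul_assoc, ← hKB]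
      gcongr
    have h4 : E.q t * (E.P t - K * g ^ t) = E.q (t + 1) *
        (E.P (t + 1) + E.r (t + 1) - K * E.R t * g ^ t) := by
      rw [mul_sub, q_mul_P hP hr t, ← q_succ_mul_R hP hr t]; ring
    rw [h4]
    refine mul_le_mul_of_nonneg_left ?_ (q_pos hP hr _).le
    rw [pow_succ]
    linarith
  refine ⟨K, eventually_atTop.2 ⟨N, fun t ht => ?_⟩⟩
  have hk : ∀ k, E.q t * (E.P t - K * g ^ t) ≤ E.q (k + t) * E.P (k + t) := by
    intro k
    have h1 : E.q t * (E.P t - K * g ^ t) ≤ E.q (k + t) * (E.P (k + t) - K * g ^ (k + t)) := by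
      induction k with
      | zero => simp
      | succ k ih =>
        rw [show k + 1 + t = k + t + 1 by ring]
        exact ih.trans (hstep (k + t) (by omega))
    refine h1.trans (mul_le_mul_of_nonneg_left ?_ (q_pos hP hr _).le)
    linarith [mul_nonneg hK0 (pow_nonneg hg.le (k + t))]
  have h0 := ge_of_tendsto' ((tendsto_add_atTop_iff_nat t).2 hq) hk
  have h1 := nonpos_of_mul_nonpos_right h0 (q_pos hP hr t)
  linarith

theorem IsEquilibrium.cy_eq_pow_mul (hγ₁ : γ < 1) (hc : IsCompositeConsumption c)
    (hE : E.IsEquilibrium (utility γ c v) ey eo) (hG : 1 < G)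
    (hT : ∀ t, T ≤ t → ey t = e₁ * G ^ t ∧ eo t = e₂ * G ^ t) {t : ℕ} (ht : T ≤ t) :
    E.cy t = G ^ t * (e₁ - E.S t / G ^ t) := by
  rw [hE.cy_eq hγ₁ hc, IsEulerPath.cons_young_eq hG hT ht]

theorem IsEquilibrium.co_succ_eq_pow_mul (hγ₁ : γ < 1) (hc : IsCompositeConsumption c)
    (hE : E.IsEquilibrium (utility γ c v) ey eo) (hG : 1 < G)
    (hT : ∀ t, T ≤ t → ey t = e₁ * G ^ t ∧ eo t = e₂ * G ^ t) {t : ℕ} (ht : T ≤ t) :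
    E.co (t + 1) = G ^ t * (G * (e₂ + E.S (t + 1) / G ^ (t + 1))) := by
  rw [hE.co_eq hγ₁ hc, IsEulerPath.cons_old_eq hG hT ht]

/-- If housing expenditure vanishes relative to the endowments, then interest rates converge to the
marginal rate of substitution at the endowments. -/
theorem IsEquilibrium.tendsto_R (hγ₁ : γ < 1) (hc : IsCompositeConsumption c)
    (hv : IsHousingUtility γ c v) (hG : 1 < G) (he₁ : 0 < e₁) (he₂ : 0 < e₂)
    (hT : ∀ t, T ≤ t → ey t = e₁ * G ^ t ∧ eo t = e₂ * G ^ t)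
    (hE : E.IsEquilibrium (utility γ c v) ey eo)
    (hS : Tendsto (fun t => E.S t / G ^ t) atTop (𝓝 0)) :
    Tendsto E.R atTop (𝓝 (mrs c e₁ (G * e₂))) := by
  have h1 : Tendsto (fun t => mrs c (e₁ - E.S t / G ^ t) (G * (e₂ + E.S (t + 1) / G ^ (t + 1))))
      atTop (𝓝 (mrs c e₁ (G * e₂))) := by
    refine tendsto_comp_of_continuousOn_posQuadrant hc.continuousOn_mrs he₁ (by positivity) ?_ ?_
    · simpa using hS.const_sub e₁
    · simpa using (((tendsto_add_atTop_iff_nat 1).2 hS).const_add e₂).const_mul G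
  refine h1.congr' ?_
  filter_upwards [eventually_ge_atTop T] with t ht
  have hpath := hE.isEulerPath hγ₁ hc hv
  have h2 := hpath.detrended_lt hG hT ht
  have h3 := hpath.detrended_pos hG (t + 1)
  rw [hE.R_eq hγ₁ hc hv, hE.cy_eq_pow_mul hγ₁ hc hG hT ht, hE.co_succ_eq_pow_mul hγ₁ hc hG hT ht,
    hc.mrs_homogeneous (by positivity) (by linarith) (by positivity)]

theorem IsEquilibrium.tendsto_rent (hγ₁ : γ < 1) (hc : IsCompositeConsumption c)
    (hv : IsHousingUtility γ c v) (hG : 1 < G) (he₁ : 0 < e₁) (he₂ : 0 < e₂)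
    (hT : ∀ t, T ≤ t → ey t = e₁ * G ^ t ∧ eo t = e₂ * G ^ t)
    (hE : E.IsEquilibrium (utility γ c v) ey eo)
    (hS : Tendsto (fun t => E.S t / G ^ t) atTop (𝓝 0)) :
    Tendsto (fun t => E.r t / (G ^ γ) ^ t) atTop
      (𝓝 (housingMRS γ (deriv v 1) c e₁ (G * e₂))) := by
  have hG0 : 0 < G := by positivity
  have hcont : ContinuousOn (fun p : ℝ × ℝ => housingMRS γ (deriv v 1) c p.1 p.2) posQuadrant :=
    (continuousOn_const.mul (hc.continuousOn.rpow_const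
      fun p hp => Or.inl (hc.pos p.1 p.2 hp.1 hp.2).ne')).div hc.continuousOn_partialY
      fun p hp => (hc.partialY_pos p.1 p.2 hp.1 hp.2).ne'
  have h1 : Tendsto (fun t => housingMRS γ (deriv v 1) c (e₁ - E.S t / G ^ t)
      (G * (e₂ + E.S (t + 1) / G ^ (t + 1)))) atTop
      (𝓝 (housingMRS γ (deriv v 1) c e₁ (G * e₂))) := by
    refine tendsto_comp_of_continuousOn_posQuadrant hcont he₁ (by positivity) ?_ ?_
    · simpa using hS.const_sub e₁
    · simpa using (((tendsto_add_atTop_iff_nat 1).2 hS).const_add e₂).const_mul G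
  refine h1.congr' ?_
  filter_upwards [eventually_ge_atTop T] with t ht
  have hpath := hE.isEulerPath hγ₁ hc hv
  have h2 := hpath.detrended_lt hG hT ht
  have h3 := hpath.detrended_pos hG (t + 1)
  have h4 : (G ^ γ) ^ t ≠ 0 := by positivity
  rw [hE.r_eq hγ₁ hc hv, hE.cy_eq_pow_mul hγ₁ hc hG hT ht, hE.co_succ_eq_pow_mul hγ₁ hc hG hT ht,
    hc.housingMRS_homogeneous (by positivity) (by linarith) (by positivity),
    ← Real.rpow_pow_comm hG0.le]
  field_simp

/-- The price of a fundamental equilibrium in which housing expenditure vanishes relative to the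
endowments is asymptotically that of a rent growing at the rate `G ^ γ`, discounted at the
autarky interest rate. -/
theorem IsEquilibrium.tendsto_price (hγ₀ : 0 < γ) (hγ₁ : γ < 1) (hc : IsCompositeConsumption c)
    (hv : IsHousingUtility γ c v) (hG : 1 < G) (he₁ : 0 < e₁) (he₂ : 0 < e₂)
    (hT : ∀ t, T ≤ t → ey t = e₁ * G ^ t ∧ eo t = e₂ * G ^ t)
    (hE : E.IsEquilibrium (utility γ c v) ey eo) (hF : E.IsFundamental)
    (hlt : G ^ γ < mrs c e₁ (G * e₂))
    (hS : Tendsto (fun t => E.S t / G ^ t) atTop (𝓝 0)) :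
    Tendsto (fun t => E.P t / (G ^ γ) ^ t) atTop
      (𝓝 (G ^ γ / (mrs c e₁ (G * e₂) - G ^ γ) *
        housingMRS γ (deriv v 1) c e₁ (G * e₂))) := by
  have hG0 : 0 < G := by positivity
  have hg : 0 < G ^ γ := Real.rpow_pos_of_pos hG0 _
  have hM : 0 < mrs c e₁ (G * e₂) := hg.trans hlt
  have hP := hE.price_pos hγ₁ hc hv
  have hr := fun t => (hE.rent_pos hγ₁ hc hv t).le
  have hR := hE.tendsto_R hγ₁ hc hv hG he₁ he₂ hT hS
  have hrent := hE.tendsto_rent hγ₁ hc hv hG he₁ he₂ hT hS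
  obtain ⟨B, hB, hrB⟩ := hE.exists_rent_le hγ₀ hγ₁ hc hv hG he₁ he₂ hT
  obtain ⟨ρ, hρ, hρ'⟩ := exists_between hlt
  obtain ⟨K, hK⟩ := exists_price_le_mul_pow hP hr hg hρ hB.le
    (eventually_atTop.2 ⟨T, fun t ht => hrB t ht⟩)
    ((hR.eventually (lt_mem_nhds hρ')).mono fun _ h => h.le) (hF.tendsto_q_mul_P hP hr)
  have hμ : Tendsto (fun t => G ^ γ / E.R t) atTop (𝓝 (G ^ γ / mrs c e₁ (G * e₂))) :=
    tendsto_const_nhds.div hR hM.ne'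
  have hlim := tendsto_of_forward_recursion (p := fun t => E.P t / (G ^ γ) ^ t) (K := K)
    (by positivity) ((div_lt_one hM).2 hlt) hμ hrent (fun t => ?_) ?_
  · convert hlim using 2
    have h1 : mrs c e₁ (G * e₂) - G ^ γ ≠ 0 := by linarith
    have h2 : 1 - G ^ γ / mrs c e₁ (G * e₂) ≠ 0 := by
      rw [one_sub_div hM.ne']; exact div_ne_zero h1 hM.ne'
    field_simp
  · have h1 : 0 < E.P (t + 1) + E.r (t + 1) := add_pos_of_pos_of_nonneg (hP _) (hr _)
    have h2 := (hP t).ne'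
    rw [R, pow_succ]
    field_simp
  · filter_upwards [hK] with t ht
    have := hP t
    rw [abs_of_pos (by positivity), div_le_iff₀ (by positivity)]
    exact ht

/-- In a fundamental long run equilibrium housing expenditure vanishes relative to the endowments:
a positive limit would create a bubble. -/
theorem IsEquilibrium.tendsto_S_div_pow (hγ₀ : 0 < γ) (hγ₁ : γ < 1)
    (hc : IsCompositeConsumption c) (hv : IsHousingUtility γ c v) (hG : 1 < G) (he₁ : 0 < e₁)
    (he₂ : 0 < e₂) (hT : ∀ t, T ≤ t → ey t = e₁ * G ^ t ∧ eo t = e₂ * G ^ t)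
    (hE : E.IsEquilibrium (utility γ c v) ey eo) (hF : E.IsFundamental)
    (hL : E.IsLongRun γ G e₁) : Tendsto (fun t => E.S t / G ^ t) atTop (𝓝 0) := by
  obtain ⟨ξ, hξ⟩ := hL
  have h1 : Tendsto (fun t => E.S t / G ^ t) atTop (𝓝 (e₁ * ξ.1)) := by
    refine (((continuous_fst.tendsto ξ).comp hξ).const_mul e₁).congr fun t => ?_
    simp only [Function.comp]
    field_simp
  have h0 : 0 ≤ e₁ * ξ.1 := ge_of_tendsto' h1 fun t =>
    ((hE.isEulerPath hγ₁ hc hv).detrended_pos hG t).le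
  rcases h0.eq_or_lt with h | h
  · rwa [← h] at h1
  · have h2 : ∀ᶠ t in atTop, e₁ * ξ.1 / 2 * G ^ t ≤ E.S t := by
      filter_upwards [h1.eventually (lt_mem_nhds (half_lt_self h))] with t ht
      exact ((lt_div_iff₀ (by positivity)).1 ht).le
    obtain ⟨hbub, -⟩ := hE.isBubbly_of_mul_pow_le hγ₀ hγ₁ hc hv hG he₁ he₂ hT (half_pos h) h2
    exact absurd (hF.2 0) (hbub.2 0).ne'

end PriceAllocation

end

/-! ### Existence of a fundamental equilibrium -/

noncomputable section

/-- If every state in `K (t + 1)` has a predecessor in `K t` under a closed relation and the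
sets `K t` are compact, then there is an infinite path: finite paths are built backwards, and
compactness passes to the limit. -/
theorem exists_path_of_backward {X : Type*} [TopologicalSpace X] {K : ℕ → Set X}
    (hK : ∀ t, IsCompact (K t)) (hne : ∀ t, (K t).Nonempty) {Z : ℕ → Set (X × X)}
    (hZ : ∀ t, IsClosed (Z t)) (hstep : ∀ t, ∀ x ∈ K (t + 1), ∃ s ∈ K t, (s, x) ∈ Z t) :
    ∃ S : ℕ → X, ∀ t, S t ∈ K t ∧ (S t, S (t + 1)) ∈ Z t := by
  have hfin : ∀ k j : ℕ, ∃ S ∈ univ.pi K, ∀ t, j ≤ t → t < j + k → (S t, S (t + 1)) ∈ Z t := by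
    intro k
    induction k with
    | zero =>
      intro j
      choose S hS using hne
      exact ⟨S, fun t _ => hS t, fun t h1 h2 => absurd h2 (by omega)⟩
    | succ k ih =>
      intro j
      obtain ⟨S, hS, hS'⟩ := ih (j + 1)
      obtain ⟨s, hs, hsZ⟩ := hstep j (S (j + 1)) (hS (j + 1) (mem_univ _))
      refine ⟨Function.update S j s, fun t _ => ?_, fun t h1 h2 => ?_⟩
      · rcases eq_or_ne t j with rfl | h
        · simpa using hs
        · simpa [h] using hS t (mem_univ _)
      · have h3 : t + 1 ≠ j := by omega
        rcases eq_or_ne t j with rfl | h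
        · simpa using hsZ
        · simpa [h, h3] using hS' t (by omega) (by omega)
  obtain ⟨S, hS, hS'⟩ := (isCompact_univ_pi hK).inter_iInter_nonempty
    (fun t => {S : ℕ → X | (S t, S (t + 1)) ∈ Z t})
    (fun t => (hZ t).preimage (by fun_prop : Continuous fun S : ℕ → X => (S t, S (t + 1))))
    (fun u => by
      obtain ⟨n, hn⟩ := u.bddAbove
      obtain ⟨S, hS, hS'⟩ := hfin (n + 1) 0
      exact ⟨S, hS, mem_iInter₂.2 fun t ht => hS' t (by omega) (by have := hn ht; omega)⟩)
  exact ⟨S, fun t => ⟨hS t (mem_univ _), mem_iInter.1 hS' t⟩⟩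

variable {γ m : ℝ} {c : ℝ → ℝ → ℝ}

theorem IsCompositeConsumption.continuousOn_euler (hc : IsCompositeConsumption c) {a b : ℝ}
    {s : Set (ℝ × ℝ)} (hs : ∀ p ∈ s, 0 < a - p.1 ∧ 0 < b + p.2) :
    ContinuousOn (fun p : ℝ × ℝ => p.1 * partialY c (a - p.1) (b + p.2) -
      (p.2 * partialZ c (a - p.1) (b + p.2) + m * c (a - p.1) (b + p.2) ^ γ)) s := by
  have hf : ContinuousOn (fun p : ℝ × ℝ => (a - p.1, b + p.2)) s := by fun_prop
  have h1 := hc.continuousOn_partialY.comp hf hs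
  have h2 := hc.continuousOn_partialZ.comp hf hs
  have h3 := hc.continuousOn.comp hf hs
  exact (continuousOn_fst.mul h1).sub ((continuousOn_snd.mul h2).add
    (continuousOn_const.mul (h3.rpow_const fun p hp =>
      Or.inl (hc.pos _ _ (hs p hp).1 (hs p hp).2).ne')))

/-- The Euler equation can be solved for current housing expenditure given any bounded future
expenditure, with the consumption of the young bounded away from zero by the Inada condition. -/
theorem IsCompositeConsumption.exists_euler_solution (hγ₀ : 0 < γ) (hm : 0 < m)
    (hc : IsCompositeConsumption c) {a b A : ℝ} (ha : 0 < a) (hb : 0 < b) :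
    ∃ ε > 0, ε < a ∧ ∀ x ∈ Icc 0 A, ∃ s ∈ Icc 0 (a - ε),
      s * partialY c (a - s) (b + x) =
        x * partialZ c (a - s) (b + x) + m * c (a - s) (b + x) ^ γ := by
  have h1 := (hc.inada_y b hb).eventually (eventually_ge_atTop
    ((A * partialZ c a b + m * c a (b + A) ^ γ) / (a / 2)))
  have h2 : ∀ᶠ y : ℝ in 𝓝[>] 0, y ∈ Ioo 0 (a / 2) := Ioo_mem_nhdsGT (by positivity)
  obtain ⟨ε, hε, hε0, hεa⟩ := (h1.and h2).exists
  rw [div_le_iff₀ (by positivity)] at hε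
  refine ⟨ε, hε0, by linarith, fun x hx => ?_⟩
  have hbx : 0 < b + x := by linarith [hx.1]
  have hcont : ContinuousOn (fun s => s * partialY c (a - s) (b + x) -
      (x * partialZ c (a - s) (b + x) + m * c (a - s) (b + x) ^ γ)) (Icc 0 (a - ε)) :=
    (hc.continuousOn_euler (γ := γ) (m := m) (a := a) (b := b)
      (s := Icc 0 (a - ε) ×ˢ {x}) (by
        rintro ⟨s, y⟩ ⟨hs, rfl⟩
        exact ⟨by linarith [hs.2], hbx⟩)).comp (f := fun s : ℝ => (s, x)) (by fun_prop)
      fun s hs => ⟨hs, rfl⟩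
  have hneg : (0 : ℝ) * partialY c (a - 0) (b + x) -
      (x * partialZ c (a - 0) (b + x) + m * c (a - 0) (b + x) ^ γ) ≤ 0 := by
    have h3 := hc.partialZ_pos a (b + x) ha hbx
    have h4 := Real.rpow_pos_of_pos (hc.pos a (b + x) ha hbx) γ
    have h5 := mul_nonneg hx.1 h3.le
    have h6 := mul_pos hm h4
    rw [sub_zero]
    linarith
  have hpos : 0 ≤ (a - ε) * partialY c (a - (a - ε)) (b + x) -
      (x * partialZ c (a - (a - ε)) (b + x) + m * c (a - (a - ε)) (b + x) ^ γ) := by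
    rw [sub_sub_cancel]
    have h3 := hc.partialY_mono hε0 le_rfl hb (by linarith [hx.1] : b ≤ b + x)
    have h4 := hc.partialZ_mono hε0 (by linarith : ε ≤ a) hb (by linarith [hx.1] : b ≤ b + x)
    have h5 : c ε (b + x) ^ γ ≤ c a (b + A) ^ γ :=
      Real.rpow_le_rpow (hc.pos _ _ hε0 hbx).le
        (hc.mono hε0 (by linarith) hbx (by linarith [hx.2])) hγ₀.le
    have h6 : a / 2 * partialY c ε b ≤ (a - ε) * partialY c ε (b + x) :=
      mul_le_mul (by linarith) h3 (hc.partialY_pos _ _ hε0 hb).le (by linarith)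
    have h7 : x * partialZ c ε (b + x) ≤ A * partialZ c a b :=
      mul_le_mul hx.2 h4 (hc.partialZ_pos _ _ hε0 hbx).le (hx.1.trans hx.2)
    have h8 := mul_le_mul_of_nonneg_left h5 hm.le
    linarith
  obtain ⟨s, hs, hs0⟩ := intermediate_value_Icc (by linarith : (0 : ℝ) ≤ a - ε) hcont
    ⟨hneg, hpos⟩
  exact ⟨s, hs, sub_eq_zero.1 hs0⟩

/-- If the interest rate `mrs c e₁ (G e₂)` at which agents consume their endowments exceeds
`G ^ γ`, then the Euler equation, solved backwards, preserves a bound of order `G ^ (γ t)`; hence it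
has a solution of that order. -/
theorem exists_isEulerPath_le_mul_pow (hγ₀ : 0 < γ) (hm : 0 < m) (hc : IsCompositeConsumption c)
    {ey eo : ℕ → ℝ} {G e₁ e₂ : ℝ} {T : ℕ} (hG : 1 < G) (he₁ : 0 < e₁) (he₂ : 0 < e₂)
    (hey : ∀ t, 0 < ey t) (heo : ∀ t, 0 < eo t)
    (hT : ∀ t, T ≤ t → ey t = e₁ * G ^ t ∧ eo t = e₂ * G ^ t)
    (hlt : G ^ γ < mrs c e₁ (G * e₂)) :
    ∃ S, IsEulerPath γ m c ey eo S ∧ ∃ K, ∀ t, T ≤ t → S t ≤ K * (G ^ γ) ^ t := by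
  have hG0 : 0 < G := by positivity
  have hg : 0 < G ^ γ := Real.rpow_pos_of_pos hG0 _
  set M := mrs c e₁ (G * e₂)
  have hM : 0 < M := hg.trans hlt
  obtain ⟨B, hB, hrB⟩ := housingMRS_le_mul_pow hγ₀ hm hc hG he₁ he₂ hT
  -- `K` is the fixed point of `K = (G ^ γ / M) K + B`
  set K := B * M / (M - G ^ γ) with hKdef
  have hK : 0 < K := div_pos (by positivity) (sub_pos.2 hlt)
  have hKfix : K * G ^ γ / M + B = K := by
    have : M - G ^ γ ≠ 0 := (sub_pos.2 hlt).ne'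
    rw [hKdef]; field_simp; ring
  choose ε hε hεey hsol using fun t => hc.exists_euler_solution (γ := γ) (A := ey (t + 1)) hγ₀ hm
    (hey t) (heo (t + 1))
  set u : ℕ → ℝ := fun t => if T ≤ t then min (ey t - ε t) (K * (G ^ γ) ^ t) else ey t - ε t
    with hu
  have hu_le : ∀ t, u t ≤ ey t - ε t := fun t => by
    simp only [hu]; split_ifs
    · exact min_le_left _ _
    · rfl
  have hu_nonneg : ∀ t, 0 ≤ u t := fun t => by
    have h1 : 0 ≤ ey t - ε t := (sub_pos.2 (hεey t)).le
    simp only [hu]; split_ifs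
    · exact le_min h1 (by positivity)
    · exact h1
  have hu_le_pow : ∀ t, T ≤ t → u t ≤ K * (G ^ γ) ^ t := fun t ht => by
    simp only [hu, if_pos ht]; exact min_le_right _ _
  let Z : ℕ → Set (ℝ × ℝ) := fun t => (Icc 0 (u t) ×ˢ Icc 0 (u (t + 1))) ∩
    (fun p : ℝ × ℝ => p.1 * partialY c (ey t - p.1) (eo (t + 1) + p.2) -
      (p.2 * partialZ c (ey t - p.1) (eo (t + 1) + p.2) +
        m * c (ey t - p.1) (eo (t + 1) + p.2) ^ γ)) ⁻¹' {0}
  have hZ : ∀ t, IsClosed (Z t) := fun t =>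
    (hc.continuousOn_euler fun p hp =>
      ⟨by linarith [hp.1.2, hu_le t, hε t], by linarith [hp.2.1, heo (t + 1)]⟩
      ).preimage_isClosed_of_isClosed (isClosed_Icc.prod isClosed_Icc) isClosed_singleton
  obtain ⟨S, hS⟩ := exists_path_of_backward (K := fun t => Icc 0 (u t)) (Z := Z)
    (fun t => isCompact_Icc) (fun t => nonempty_Icc.2 (hu_nonneg t)) hZ (fun t x hx => by
      have hx1 : x ≤ ey (t + 1) := by linarith [hx.2, hu_le (t + 1), hε (t + 1)]
      obtain ⟨s, hs, hse⟩ := hsol t x ⟨hx.1, hx1⟩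
      have hsu : s ≤ u t := by
        simp only [hu]
        split_ifs with ht
        · refine le_min hs.2 ?_
          have hsey : s < ey t := by linarith [hs.2, hε t]
          have hy : 0 < ey t - s := sub_pos.2 hsey
          have hz : 0 < eo (t + 1) + x := by linarith [hx.1, heo (t + 1)]
          have hr := hrB t ht s x hs.1 hsey hx.1 hx1
          have hY := hc.partialY_pos _ _ hy hz
          have hmrs : M ≤ mrs c (ey t - s) (eo (t + 1) + x) := by
            have hGt : 0 < G ^ t := by positivity
            refine (hc.mrs_homogeneous hGt he₁ (by positivity : 0 < G * e₂)).symm.trans_le ?_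
            refine hc.mrs_mono hy ?_ (by positivity) ?_
            · rw [(hT t ht).1]; linarith [hs.1]
            · rw [(hT (t + 1) (by omega)).2, pow_succ]; linarith [hx.1]
          have hseq : s = x / mrs c (ey t - s) (eo (t + 1) + x) +
              housingMRS γ m c (ey t - s) (eo (t + 1) + x) := by
            rw [mrs, housingMRS, div_div_eq_mul_div, ← add_div, eq_div_iff hY.ne', hse]
          have hx2 : x ≤ K * (G ^ γ) ^ (t + 1) := hx.2.trans (hu_le_pow _ (by omega))
          calc s = x / mrs c (ey t - s) (eo (t + 1) + x) +
                housingMRS γ m c (ey t - s) (eo (t + 1) + x) := hseq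
            _ ≤ K * (G ^ γ) ^ (t + 1) / M + B * (G ^ γ) ^ t :=
                add_le_add (div_le_div₀ (by positivity) hx2 hM hmrs) hr
            _ = (K * G ^ γ / M + B) * (G ^ γ) ^ t := by rw [pow_succ]; ring
            _ = K * (G ^ γ) ^ t := by rw [hKfix]
        · exact hs.2
      exact ⟨s, ⟨hs.1, hsu⟩, ⟨⟨hs.1, hsu⟩, hx⟩, by simpa using sub_eq_zero.2 hse⟩)
  have hlt' : ∀ t, S t < ey t := fun t => by linarith [(hS t).1.2, hu_le t, hε t]
  have heuler : ∀ t, S t * partialY c (ey t - S t) (eo (t + 1) + S (t + 1)) =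
      S (t + 1) * partialZ c (ey t - S t) (eo (t + 1) + S (t + 1)) +
        m * c (ey t - S t) (eo (t + 1) + S (t + 1)) ^ γ := fun t => by
    have h1 := (hS t).2.2
    exact sub_eq_zero.1 h1
  refine ⟨S, ⟨fun t => ?_, hlt', heuler⟩, K, fun t ht => (hS t).1.2.trans (hu_le_pow t ht)⟩
  have hy : 0 < ey t - S t := sub_pos.2 (hlt' t)
  have hz : 0 < eo (t + 1) + S (t + 1) := by linarith [(hS (t + 1)).1.1, heo (t + 1)]
  refine pos_of_mul_pos_left (b := partialY c (ey t - S t) (eo (t + 1) + S (t + 1))) ?_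
    (hc.partialY_pos _ _ hy hz).le
  rw [heuler t]
  exact add_pos_of_nonneg_of_pos
    (mul_nonneg (hS (t + 1)).1.1 (hc.partialZ_pos _ _ hy hz).le)
    (mul_pos hm (Real.rpow_pos_of_pos (hc.pos _ _ hy hz) _))

theorem tendsto_rpow_sub_one_mul {γ G e₁ : ℝ} (hγ₁ : γ < 1) (hG : 1 < G) :
    Tendsto (fun t : ℕ => e₁ ^ (γ - 1) * G ^ ((γ - 1) * (t : ℝ))) atTop (𝓝 0) := by
  have hG0 : 0 < G := by positivity
  have h1 : G ^ (γ - 1) < 1 := Real.rpow_lt_one_of_one_lt_of_neg hG (by linarith)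
  have h2 := (tendsto_pow_atTop_nhds_zero_of_lt_one (Real.rpow_pos_of_pos hG0 (γ - 1)).le
    h1).const_mul (e₁ ^ (γ - 1))
  rw [mul_zero] at h2
  exact h2.congr fun t => by rw [Real.rpow_mul_natCast hG0.le]

namespace PriceAllocation

variable {v : ℝ → ℝ} {ey eo : ℕ → ℝ} {G e₁ e₂ : ℝ} {T : ℕ}

theorem exists_fundamental_longRun (hγ₀ : 0 < γ) (hγ₁ : γ < 1) (hc : IsCompositeConsumption c)
    (hv : IsHousingUtility γ c v) (hG : 1 < G) (he₁ : 0 < e₁) (he₂ : 0 < e₂)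
    (hey : ∀ t, 0 < ey t) (heo : ∀ t, 0 < eo t)
    (hT : ∀ t, T ≤ t → ey t = e₁ * G ^ t ∧ eo t = e₂ * G ^ t)
    (hlt : G ^ γ < mrs c e₁ (G * e₂)) :
    ∃ E : PriceAllocation, E.IsEquilibrium (utility γ c v) ey eo ∧ E.IsFundamental ∧
      E.IsLongRun γ G e₁ := by
  have hG0 : 0 < G := by positivity
  have hg : 0 < G ^ γ := Real.rpow_pos_of_pos hG0 _
  have hgG : G ^ γ < G := by simpa using Real.rpow_lt_rpow_of_exponent_lt hG hγ₁
  obtain ⟨S, hS, K, hK⟩ := exists_isEulerPath_le_mul_pow hγ₀ (hv.deriv_pos 1 one_pos) hc hG he₁ he₂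
    hey heo hT hlt
  have hE := hS.isEquilibrium hγ₁ hc hv heo
  set E := eulerAllocation γ (deriv v 1) c ey eo S
  have hES : E.S = S := eulerAllocation_S
  have hP := hE.price_pos hγ₁ hc hv
  have hr := fun t => (hE.rent_pos hγ₁ hc hv t).le
  have hSG : Tendsto (fun t => E.S t / G ^ t) atTop (𝓝 0) := by
    have h1 := (tendsto_pow_atTop_nhds_zero_of_lt_one (r := G ^ γ / G) (by positivity)
      ((div_lt_one hG0).2 hgG)).const_mul K
    rw [mul_zero] at h1
    refine tendsto_of_tendsto_of_tendsto_of_le_of_le' tendsto_const_nhds h1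
      (Eventually.of_forall fun t => ?_) ?_
    · rw [hES]; exact (hS.detrended_pos hG t).le
    · filter_upwards [eventually_ge_atTop T] with t ht
      rw [hES, div_pow, ← mul_div_assoc]
      exact div_le_div_of_nonneg_right (hK t ht) (by positivity)
  refine ⟨E, hE, isFundamental_of_tendsto_q_mul_P hP hr ?_, (0, 0), ?_⟩
  · have hR : ∀ t, T ≤ t → mrs c e₁ (G * e₂) ≤ E.R t := fun t ht => by
      have h1 := hS.detrended_lt hG hT ht
      have h2 := hS.detrended_pos hG t
      have h3 := hS.detrended_pos hG (t + 1)
      rw [hE.R_eq hγ₁ hc hv, hE.cy_eq_pow_mul hγ₁ hc hG hT ht,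
        hE.co_succ_eq_pow_mul hγ₁ hc hG hT ht, hES,
        hc.mrs_homogeneous (by positivity) (by linarith) (by positivity)]
      exact hc.mrs_mono (by linarith) (by linarith) (by positivity) (by gcongr; linarith)
    set M := mrs c e₁ (G * e₂)
    have hM : 0 < M := hg.trans hlt
    have hq : ∀ k, E.q (k + T) ≤ E.q T / M ^ k := by
      intro k
      induction k with
      | zero => simp
      | succ k ih =>
        have h1 := q_succ_mul_R hP hr (k + T)
        have h2 := mul_le_mul_of_nonneg_left (hR (k + T) (by omega)) (q_pos hP hr (k + T + 1)).le
        rw [show k + 1 + T = k + T + 1 by ring, pow_succ, ← div_div, le_div_iff₀ hM]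
        linarith
    rw [← tendsto_add_atTop_iff_nat T]
    have h1 := (tendsto_pow_atTop_nhds_zero_of_lt_one (r := G ^ γ / M) (by positivity)
      ((div_lt_one hM).2 hlt)).const_mul (E.q T * (K * (G ^ γ) ^ T))
    rw [mul_zero] at h1
    refine squeeze_zero (fun k => (mul_pos (q_pos hP hr _) (hP _)).le) (fun k => ?_) h1
    have hPS : E.P (k + T) ≤ K * (G ^ γ) ^ (k + T) := by
      refine le_trans ?_ (hK (k + T) (by omega))
      rw [← hES, PriceAllocation.S]
      linarith [hr (k + T)]
    refine (mul_le_mul (hq k) hPS (hP _).le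
      (div_nonneg (q_pos hP hr _).le (by positivity))).trans_eq ?_
    rw [pow_add, div_pow]
    ring
  · refine Tendsto.prodMk_nhds ?_ (tendsto_rpow_sub_one_mul hγ₁ hG)
    have h1 := hSG.div_const e₁
    rw [zero_div] at h1
    exact h1.congr fun t => by rw [div_div, mul_comm]

end PriceAllocation

end

/-! ### Existence and nonexistence of fundamental equilibria -/

theorem isEquivalent_mul_of_tendsto_div {f g : ℕ → ℝ} {a : ℝ} (ha : a ≠ 0)
    (h : Tendsto (fun t => f t / g t) atTop (𝓝 a)) : f ~[atTop] fun t => a * g t := by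
  refine isEquivalent_of_tendsto_one ?_
  have h1 := h.div_const a
  rw [div_self ha] at h1
  exact h1.congr fun t => by simp only [Pi.div_apply]; rw [div_div, mul_comm]

theorem theorem3 (γ G e₁ e₂ : ℝ) (c : ℝ → ℝ → ℝ) (v : ℝ → ℝ) (ey eo : ℕ → ℝ)
    (hγ₀ : 0 < γ) (hγ₁ : γ < 1) (hG : 1 < G) (he₁ : 0 < e₁) (he₂ : 0 < e₂)
    (hc : IsCompositeConsumption c) (hv : IsHousingUtility γ c v)
    (he : IsEndowment G e₁ e₂ ey eo) :
    let m : ℝ := deriv v 1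
    let w : ℝ := e₂ / e₁
    -- the values of `c` and of its partial derivatives at `(1, G w)`
    let C : ℝ := c 1 (G * w)
    let Cy : ℝ := partialY c 1 (G * w)
    let Cz : ℝ := partialZ c 1 (G * w)
    let IsEq : PriceAllocation → Prop := fun E => E.IsEquilibrium (utility γ c v) ey eo
    (∃! wf : ℝ, 0 < wf ∧ partialY c 1 (G * wf) / partialZ c 1 (G * wf) = G ^ γ) ∧
    ∀ wf : ℝ, 0 < wf → partialY c 1 (G * wf) / partialZ c 1 (G * wf) = G ^ γ →
      (wf < w →
        (∃ E, IsEq E ∧ E.IsFundamental ∧ E.IsLongRun γ G e₁) ∧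
        (∀ E, IsEq E → E.IsFundamental → E.IsLongRun γ G e₁ →
          E.cy ~[atTop] (fun t : ℕ => e₁ * G ^ t) ∧
          E.co ~[atTop] (fun t : ℕ => e₂ * G ^ t) ∧
          E.P ~[atTop] (fun t : ℕ =>
            m * e₁ ^ γ * (G ^ γ * Cz / (Cy - G ^ γ * Cz)) * (C ^ γ / Cy) * G ^ (γ * (t : ℝ))) ∧
          E.r ~[atTop] (fun t : ℕ => m * e₁ ^ γ * (C ^ γ / Cy) * G ^ (γ * (t : ℝ))) ∧
          E.R ~[atTop] (fun _ : ℕ => Cy / Cz)) ∧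
        G ^ γ < Cy / Cz) ∧
      (w < wf →
        (¬ ∃ E, IsEq E ∧ E.IsFundamental) ∧
        ∀ E, IsEq E → E.IsBubbly ∧
          (0 : EReal) < liminf (fun t : ℕ => ((E.P t / G ^ t : ℝ) : EReal)) atTop) := by
  intro m w C Cy Cz IsEq
  have hG0 : 0 < G := by positivity
  have hg : 0 < G ^ γ := Real.rpow_pos_of_pos hG0 _
  have hw : 0 < w := div_pos he₂ he₁
  obtain ⟨T, hT⟩ := he.eventually_growth
  have hm : 0 < m := hv.deriv_pos 1 one_pos
  have hC : 0 < C := hc.pos _ _ one_pos (by positivity)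
  have hCy : 0 < Cy := hc.partialY_pos _ _ one_pos (by positivity)
  have hCz : 0 < Cz := hc.partialZ_pos _ _ one_pos (by positivity)
  have hGe : G * e₂ = e₁ * (G * w) := by simp only [w]; field_simp
  have hM : mrs c e₁ (G * e₂) = Cy / Cz := by
    have h1 := hc.mrs_homogeneous he₁ one_pos (mul_pos hG0 hw)
    rwa [mul_one, ← hGe] at h1
  have hρ : housingMRS γ m c e₁ (G * e₂) = m * e₁ ^ γ * (C ^ γ / Cy) := by
    have h1 := hc.housingMRS_homogeneous (γ := γ) (m := m) he₁ one_pos (mul_pos hG0 hw)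
    rw [mul_one, ← hGe] at h1
    rw [h1, housingMRS]
    ring
  refine ⟨?_, fun wf hwf hwfeq => ⟨fun hlt => ?_, fun hlt => ?_⟩⟩
  · obtain ⟨z, ⟨hz, hz1⟩, huniq⟩ := hc.existsUnique_mrs_eq hg
    refine ⟨z / G, ⟨by positivity, ?_⟩, fun w' hw' => ?_⟩
    · rwa [mul_div_cancel₀ z hG0.ne']
    · rw [eq_div_iff hG0.ne', mul_comm]
      exact huniq _ ⟨mul_pos hG0 hw'.1, hw'.2⟩
  · have hgM : G ^ γ < Cy / Cz :=
      hwfeq ▸ hc.mrs_strictMono one_pos (by positivity) (mul_lt_mul_of_pos_left hlt hG0)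
    have hgM' : G ^ γ < mrs c e₁ (G * e₂) := hM ▸ hgM
    refine ⟨PriceAllocation.exists_fundamental_longRun hγ₀ hγ₁ hc hv hG he₁ he₂ he.young_pos
        he.old_pos hT hgM',
      fun E hE hF hL => ?_, hgM⟩
    have hS := hE.tendsto_S_div_pow hγ₀ hγ₁ hc hv hG he₁ he₂ hT hF hL
    have hpow : ∀ t : ℕ, G ^ (γ * (t : ℝ)) = (G ^ γ) ^ t := fun t =>
      Real.rpow_mul_natCast hG0.le γ t
    have hGt : ∀ t : ℕ, G ^ t ≠ 0 := fun t => by positivity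
    have hd : 0 < Cy - G ^ γ * Cz := by
      rw [lt_div_iff₀ hCz] at hgM
      linarith
    simp only [hpow]
    refine ⟨?_, ?_, ?_, ?_, ?_⟩
    · refine isEquivalent_mul_of_tendsto_div he₁.ne' ?_
      have h1 := hS.const_sub e₁
      rw [sub_zero] at h1
      refine h1.congr' ?_
      filter_upwards [eventually_ge_atTop T] with t ht
      rw [hE.cy_eq_pow_mul hγ₁ hc hG hT ht, mul_div_cancel_left₀ _ (hGt t)]
    · refine isEquivalent_mul_of_tendsto_div he₂.ne' ?_
      have h1 := hS.const_add e₂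
      rw [add_zero] at h1
      refine h1.congr' ?_
      filter_upwards [eventually_ge_atTop T] with t ht
      rw [hE.co_eq hγ₁ hc, (hT t ht).2, add_div, mul_div_cancel_right₀ _ (hGt t)]
    · refine isEquivalent_mul_of_tendsto_div (by positivity) ?_
      convert hE.tendsto_price hγ₀ hγ₁ hc hv hG he₁ he₂ hT hF hgM' hS using 2
      rw [hM, hρ]
      have h1 := hd.ne'
      have h2 : Cy / Cz - G ^ γ ≠ 0 := (sub_pos.2 hgM).ne'
      have h3 : Cy / Cz - G ^ γ = (Cy - G ^ γ * Cz) / Cz := by field_simp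
      rw [h3]
      field_simp
    · refine isEquivalent_mul_of_tendsto_div (by positivity) ?_
      rw [← hρ]
      exact hE.tendsto_rent hγ₁ hc hv hG he₁ he₂ hT hS
    · refine (isEquivalent_const_iff_tendsto (div_pos hCy hCz).ne').2 ?_
      rw [← hM]
      exact hE.tendsto_R hγ₁ hc hv hG he₁ he₂ hT hS
  · have hgM : mrs c e₁ (G * e₂) < G ^ γ := by
      rw [hM, ← hwfeq]
      exact hc.mrs_strictMono one_pos (by positivity) (mul_lt_mul_of_pos_left hlt hG0)
    have hbub : ∀ E : PriceAllocation, IsEq E → E.IsBubbly ∧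
        (0 : EReal) < liminf (fun t : ℕ => ((E.P t / G ^ t : ℝ) : EReal)) atTop := by
      intro E hE
      obtain ⟨δ, hδ, hδS⟩ := (hE.isEulerPath hγ₁ hc hv).exists_mul_pow_le hγ₀ hγ₁ hm hc hG he₁ he₂
        he.old_pos hT hgM
      obtain ⟨h1, h2⟩ := hE.isBubbly_of_mul_pow_le hγ₀ hγ₁ hc hv hG he₁ he₂ hT hδ
        (eventually_atTop.2 ⟨T, hδS⟩)
      refine ⟨h1, lt_of_lt_of_le (EReal.coe_pos.2 (half_pos hδ)) (le_liminf_of_le ?_ ?_)⟩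
      · isBoundedDefault
      · filter_upwards [h2] with t ht
        exact EReal.coe_le_coe_iff.2 ((le_div_iff₀ (by positivity)).2 ht)
    refine ⟨?_, hbub⟩
    rintro ⟨E, hE, hF⟩
    exact absurd (hF.2 0) ((hbub E hE).1.2 0).ne'
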